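/- Let $k\in\mathbb N=\{1,2,\dots\}$, $\boldsymbol n=(n_1,\dots,n_k)\in\mathbb N^k$ and $n=n_1+\cdots+n_k$; write $z=(z_{(1)},\dots,z_{(k)})\in\mathbb C^n=\mathbb C^{n_1}\times\cdots\times\mathbb C^{n_k}$. Let $d\lambda_n(w)=\pi^{-n}e^{-|w|^2}dw$ be the Gaussian measure on $\mathbb C^n$. For $a\in L^\infty(\mathbb R_+^k)$, with $\mathbb R_+=(0,\infty)$, let $T_{\boldsymbol n,a}$ be the Toeplitz operator on the Fock space of $\mathbb C^n$ with quasi-radial symbol $\varphi(z)=a(|z_{(1)}|,\dots,|z_{(k)}|)$, that is $$T_{\boldsymbol n,a}f(z)=\int_{\mathbb C^n}\varphi(w)\,f(w)\,\overline{e^{\langle w,z\rangle}}\,d\lambda_n(w),\qquad \langle w,z\rangle=\sum_i w_i\overline{z_i}.$$ The eigenvalue function $\gamma_{\boldsymbol n,a}:\mathbb N_0^k\to\mathbb C$ of $T_{\boldsymbol n,a}$ is the function such that, for every $\boldsymbol m\in\mathbb N_0^k$, $T_{\boldsymbol n,a}f=\gamma_{\boldsymbol n,a}(\boldsymbol m)f$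 for every polynomial $f$ on $\mathbb C^n$ that is homogeneous of degree $m_j$ in $z_{(j)}$ for each $j=1,\dots,k$. Let $C_{b,u}(\mathbb N_0,\rho_1)$ be the C*-algebra, with the sup norm, of the bounded functions $\mathbb N_0\to\mathbb C$ that are uniformly continuous with respect to the square-root metric $\rho_1(m,m')=|\sqrt m-\sqrt{m'}|$. The C*-tensor product $C_{b,u}(\mathbb N_0,\rho_1)\otimes\cdots\otimes C_{b,u}(\mathbb N_0,\rho_1)$ of $k$ copies is identified with the closure in $\ell^\infty(\mathbb N_0^k)$ of the linear span of the functions $\boldsymbol m\mapsto f_1(m_1)\cdots f_k(m_k)$ with $f_j\in C_{b,u}(\mathbb N_0,\rho_1)$. Let $L^\infty(\mathbb R_+)\otimes\cdots\otimes L^\infty(\mathbb R_+)\subseteq L^\infty(\mathbb R_+^k)$ be the algebraic tensor product, i.e. the linear span of the functions $r\mapsto b_1(r_1)\cdots b_k(r_k)$ with $b_j\in L^\infty(\mathbb R_+)$. Then for every $a\in L^\infty(\mathbb R_+)\otimes\cdots\otimes L^\infty(\mathbb R_+)$ there is exactly one bounded eigenvalue function $\gamma_{\boldsymbol n,a}$,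 and the set $$\tilde{\mathfrak G}_{\boldsymbol n}=\{\gamma_{\boldsymbol n,a}\mid a\in L^\infty(\mathbb R_+)\otimes\cdots\otimes L^\infty(\mathbb R_+)\}$$ is contained and dense in $C_{b,u}(\mathbb N_0,\rho_1)\otimes\cdots\otimes C_{b,u}(\mathbb N_0,\rho_1)$. -/

import Mathlib

open MeasureTheory
open scoped BoundedContinuousFunction TensorProduct ENNReal

noncomputable section

namespace QuasiRadial

/-! ### Square-root-slowly-oscillating functions -/

/-- `ℓ^∞(ℕ₀^k)`: all bounded functions `ℕ₀^k → ℂ` with the sup norm and pointwise operations.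
The product topology on `Fin k → ℕ` is discrete, so continuity is no restriction. -/
abbrev LInfty (k : ℕ) : Type := (Fin k → ℕ) →ᵇ ℂ

/-- The square-root metric `ρ_k(m, m') = ∑ j, |√m_j - √m'_j|` on `ℕ₀^k`. -/
def sqrtDist {k : ℕ} (m m' : Fin k → ℕ) : ℝ :=
  ∑ j, |Real.sqrt (m j : ℝ) - Real.sqrt (m' j : ℝ)|

/-- Uniform continuity with respect to the square-root metric. -/
def SqrtUniformContinuous {k : ℕ} (σ : (Fin k → ℕ) → ℂ) : Prop :=
  ∀ ε : ℝ, 0 < ε → ∃ δ : ℝ, 0 < δ ∧ ∀ m m' : Fin k → ℕ, sqrtDist m m' < δ → ‖σ m - σ m'‖ < ε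

theorem SqrtUniformContinuous.add {k : ℕ} {σ τ : (Fin k → ℕ) → ℂ}
    (hσ : SqrtUniformContinuous σ) (hτ : SqrtUniformContinuous τ) :
    SqrtUniformContinuous (fun m => σ m + τ m) := by
  intro ε hε
  obtain ⟨δ₁, h₁, H₁⟩ := hσ (ε / 2) (half_pos hε)
  obtain ⟨δ₂, h₂, H₂⟩ := hτ (ε / 2) (half_pos hε)
  refine ⟨min δ₁ δ₂, lt_min h₁ h₂, fun m m' h => ?_⟩
  have e : σ m + τ m - (σ m' + τ m') = (σ m - σ m') + (τ m - τ m') := by ring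
  rw [e]
  have a := H₁ m m' (h.trans_le (min_le_left _ _))
  have b := H₂ m m' (h.trans_le (min_le_right _ _))
  have c := norm_add_le (σ m - σ m') (τ m - τ m')
  linarith

theorem SqrtUniformContinuous.mul {k : ℕ} {σ τ : LInfty k}
    (hσ : SqrtUniformContinuous σ) (hτ : SqrtUniformContinuous τ) :
    SqrtUniformContinuous (fun m => σ m * τ m) := by
  intro ε hε
  have hC : 0 < ‖σ‖ + ‖τ‖ + 1 := by positivity
  obtain ⟨δ₁, h₁, H₁⟩ := hσ (ε / (‖σ‖ + ‖τ‖ + 1)) (div_pos hε hC)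
  obtain ⟨δ₂, h₂, H₂⟩ := hτ (ε / (‖σ‖ + ‖τ‖ + 1)) (div_pos hε hC)
  refine ⟨min δ₁ δ₂, lt_min h₁ h₂, fun m m' h => ?_⟩
  have e : σ m * τ m - σ m' * τ m' = (σ m - σ m') * τ m + σ m' * (τ m - τ m') := by ring
  rw [e]
  have a := H₁ m m' (h.trans_le (min_le_left _ _))
  have b := H₂ m m' (h.trans_le (min_le_right _ _))
  have c : ‖(σ m - σ m') * τ m + σ m' * (τ m - τ m')‖
      ≤ ‖σ m - σ m'‖ * ‖τ m‖ + ‖σ m'‖ * ‖τ m - τ m'‖ :=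
    (norm_add_le _ _).trans (by rw [norm_mul, norm_mul])
  have d₁ := τ.norm_coe_le_norm m
  have d₂ := σ.norm_coe_le_norm m'
  set η := ε / (‖σ‖ + ‖τ‖ + 1) with hη
  have hη0 : 0 < η := div_pos hε hC
  have hηε : η * (‖σ‖ + ‖τ‖ + 1) = ε := div_mul_cancel₀ _ hC.ne'
  have f₁ : ‖σ m - σ m'‖ * ‖τ m‖ ≤ η * ‖τ‖ :=
    mul_le_mul a.le d₁ (norm_nonneg _) hη0.le
  have f₂ : ‖σ m'‖ * ‖τ m - τ m'‖ ≤ ‖σ‖ * η :=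
    mul_le_mul d₂ b.le (norm_nonneg _) (norm_nonneg _)
  nlinarith

/-- The C⋆-algebra `C_{b,u}(ℕ₀^k, ρ_k)` of bounded functions on `ℕ₀^k` that are uniformly
continuous with respect to the square-root metric, as a ⋆-subalgebra of `ℓ^∞(ℕ₀^k)`. -/
def Cbu (k : ℕ) : StarSubalgebra ℂ (LInfty k) where
  carrier := {σ | SqrtUniformContinuous σ}
  mul_mem' := fun {σ τ} hσ hτ => SqrtUniformContinuous.mul (σ := σ) (τ := τ) hσ hτ
  add_mem' := fun {σ τ} hσ hτ => SqrtUniformContinuous.add (σ := σ) (τ := τ) hσ hτ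
  algebraMap_mem' := fun c ε hε => ⟨1, one_pos, fun m m' _ => by simpa using hε⟩
  star_mem' := fun {σ} hσ ε hε => by
    obtain ⟨δ, h, H⟩ := hσ ε hε
    refine ⟨δ, h, fun m m' hm => ?_⟩
    have := H m m' hm
    simpa [← map_sub] using this

/-! ### The C⋆-tensor product of `k` copies of `C_{b,u}(ℕ₀, ρ₁)` -/

/-- The homomorphism `f ↦ (m ↦ f(m_j))`, from functions of one variable to functions of `k`
variables. -/
def pullback {k : ℕ} (j : Fin k) : Cbu 1 →ₐ[ℂ] LInfty k where
  toFun f := (f : LInfty 1).compContinuous ⟨fun m _ => m j, by fun_prop⟩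
  map_one' := rfl
  map_mul' _ _ := rfl
  map_zero' := rfl
  map_add' _ _ := rfl
  commutes' _ := rfl

/-- The multilinear map `(f₁, …, f_k) ↦ (m ↦ f₁(m₁) ⋯ f_k(m_k))`. -/
def elementaryTensor (k : ℕ) : MultilinearMap ℂ (fun _ : Fin k => Cbu 1) (LInfty k) :=
  (MultilinearMap.mkPiAlgebra ℂ (Fin k) (LInfty k)).compLinearMap
    fun j => (pullback j).toLinearMap

theorem elementaryTensor_apply {k : ℕ} (f : Fin k → Cbu 1) :
    elementaryTensor k f = ∏ j, pullback j (f j) := rfl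

theorem elementaryTensor_one (k : ℕ) : elementaryTensor k 1 = 1 := by
  rw [elementaryTensor_apply]
  exact Finset.prod_eq_one fun j _ => map_one (pullback j)

theorem elementaryTensor_mul {k : ℕ} (f g : Fin k → Cbu 1) :
    elementaryTensor k (f * g) = elementaryTensor k f * elementaryTensor k g := by
  rw [elementaryTensor_apply, elementaryTensor_apply, elementaryTensor_apply,
    ← Finset.prod_mul_distrib]
  exact Finset.prod_congr rfl fun j _ => map_mul (pullback j) (f j) (g j)

/-- The canonical homomorphism from the algebraic tensor product
`C_{b,u}(ℕ₀, ρ₁) ⊗ ⋯ ⊗ C_{b,u}(ℕ₀, ρ₁)` to `ℓ^∞(ℕ₀^k)`, which sends `f₁ ⊗ ⋯ ⊗ f_k` to the function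
`m ↦ f₁(m₁) ⋯ f_k(m_k)`. -/
def tensorToFun (k : ℕ) : (⨂[ℂ] _ : Fin k, Cbu 1) →ₐ[ℂ] LInfty k :=
  PiTensorProduct.liftAlgHom (elementaryTensor k) (elementaryTensor_one k) elementaryTensor_mul

theorem tensorToFun_tprod {k : ℕ} (f : Fin k → Cbu 1) :
    tensorToFun k (PiTensorProduct.tprod ℂ f) = ∏ j, pullback j (f j) := by
  rw [tensorToFun, PiTensorProduct.liftAlgHom_apply, PiTensorProduct.lift.tprod]
  rfl

theorem tensorToFun_tprod_apply {k : ℕ} (f : Fin k → Cbu 1) (m : Fin k → ℕ) :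
    tensorToFun k (PiTensorProduct.tprod ℂ f) m = ∏ j, (f j : LInfty 1) (fun _ => m j) := by
  rw [tensorToFun_tprod]
  have h : ∀ s : Finset (Fin k), (∏ j ∈ s, pullback j (f j)) m
      = ∏ j ∈ s, (f j : LInfty 1) (fun _ => m j) := by
    intro s
    induction s using Finset.cons_induction with
    | empty => simp
    | cons a s ha ih =>
      rw [Finset.prod_cons, Finset.prod_cons, BoundedContinuousFunction.mul_apply, ih]
      rfl
  exact h _

theorem star_pullback {k : ℕ} (j : Fin k) (f : Cbu 1) :
    star (pullback j f) = pullback j (star f) := rfl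

/-- The image of the algebraic tensor product, i.e. the span of the functions
`m ↦ f₁(m₁) ⋯ f_k(m_k)` with `f_j ∈ C_{b,u}(ℕ₀, ρ₁)`. -/
def algTensor (k : ℕ) : StarSubalgebra ℂ (LInfty k) where
  toSubalgebra := (tensorToFun k).range
  star_mem' := by
    rintro _ ⟨x, rfl⟩
    change star (tensorToFun k x) ∈ (tensorToFun k).range
    induction x using PiTensorProduct.induction_on with
    | smul_tprod r f =>
      rw [map_smul, star_smul, tensorToFun_tprod, star_prod]
      simp only [star_pullback]
      rw [← tensorToFun_tprod (fun j => star (f j)), ← map_smul]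
      exact ⟨_, rfl⟩
    | add x y hx hy =>
      rw [map_add, star_add]
      exact add_mem hx hy

/-- The C⋆-tensor product `C_{b,u}(ℕ₀, ρ₁) ⊗ ⋯ ⊗ C_{b,u}(ℕ₀, ρ₁)` (`k` factors), in its spatial
realization. The algebra `C_{b,u}(ℕ₀, ρ₁) ⊆ ℓ^∞(ℕ₀)` acts faithfully on the Hilbert space `ℓ²(ℕ₀)`
by multiplication, so the algebraic tensor product acts on
`ℓ²(ℕ₀) ⊗ ⋯ ⊗ ℓ²(ℕ₀) = ℓ²(ℕ₀^k)` by multiplication with functions, the operator norm is the sup norm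
of these functions, and the tensor product is the closure in `ℓ^∞(ℕ₀^k)`. It is the completion of
the algebraic tensor product (see `tensorToFun_injective`) in a C⋆-norm, and commutative
C⋆-algebras are nuclear, so that there is no other C⋆-norm to complete in. -/
def cstarTensor (k : ℕ) : StarSubalgebra ℂ (LInfty k) :=
  (algTensor k).topologicalClosure

/-- Products `x ↦ u_{p_1}(x_1) ⋯ u_{p_k}(x_k)` of linearly independent functions are linearly
independent. -/
theorem prod_independent {X κ : Type*} {u : κ → X → ℂ} (hu : LinearIndependent ℂ u)
    (S : Finset κ) (k : ℕ) (c : (Fin k → κ) → ℂ)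
    (h : ∀ x : Fin k → X,
      ∑ p ∈ Fintype.piFinset (fun _ : Fin k => S), c p * ∏ j, u (p j) (x j) = 0) :
    ∀ p ∈ Fintype.piFinset (fun _ : Fin k => S), c p = 0 := by
  induction k with
  | zero =>
    intro p hp
    have := h (fun j => j.elim0)
    have e : Fintype.piFinset (fun _ : Fin 0 => S) = {p} := by
      ext q; simp [Subsingleton.elim q default, Subsingleton.elim p default]
    rw [e] at this
    simpa using this
  | succ k ih =>
    have key : ∀ q ∈ S, ∀ y : Fin k → X,
        ∑ p ∈ Fintype.piFinset (fun _ : Fin k => S),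
          c (Fin.cons q p : Fin (k + 1) → κ) * ∏ j, u (p j) (y j) = 0 := by
      intro q hq y
      refine linearIndependent_iff'.1 hu S (fun q => ∑ p ∈ Fintype.piFinset (fun _ : Fin k => S),
          c (Fin.cons q p : Fin (k + 1) → κ) * ∏ j, u (p j) (y j)) ?_ q hq
      funext x
      rw [Finset.sum_apply, Pi.zero_apply, ← h (Fin.cons x y)]
      simp only [Pi.smul_apply, smul_eq_mul, Finset.sum_mul]
      rw [← Finset.sum_product']
      refine Finset.sum_nbij' (fun z => (Fin.cons z.1 z.2 : Fin (k + 1) → κ))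
        (fun p => (p 0, Fin.tail p)) ?_ ?_ ?_ ?_ ?_
      · rintro ⟨a, b⟩ hab
        simp only [Finset.mem_product, Fintype.mem_piFinset] at hab ⊢
        intro j
        refine Fin.cases ?_ (fun i => ?_) j
        · exact hab.1
        · exact hab.2 i
      · intro p hp
        simp only [Finset.mem_product, Fintype.mem_piFinset] at hp ⊢
        exact ⟨hp 0, fun i => hp i.succ⟩
      · rintro ⟨a, b⟩ _
        simp
      · intro p _
        simp
      · rintro ⟨a, b⟩ _
        simp only [Fin.prod_univ_succ, Fin.cons_zero, Fin.cons_succ]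
        ring
    intro p hp
    rw [Fintype.mem_piFinset] at hp
    have := ih (fun p' => c (Fin.cons (p 0) p' : Fin (k + 1) → κ)) (key (p 0) (hp 0))
      (Fin.tail p) (by rw [Fintype.mem_piFinset]; exact fun i => hp i.succ)
    simpa using this

/-- An element of `C_{b,u}(ℕ₀, ρ₁)` as a function on `ℕ`. -/
def coordFun : Cbu 1 →ₗ[ℂ] (ℕ → ℂ) where
  toFun f := fun i => (f : LInfty 1) (fun _ => i)
  map_add' _ _ := rfl
  map_smul' _ _ := rfl

theorem coordFun_injective : Function.Injective coordFun := by
  intro f g hfg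
  apply Subtype.ext
  ext m
  have h := congrFun hfg (m 0)
  have e : (fun _ : Fin 1 => m 0) = m := by
    funext j; rw [Subsingleton.elim j 0]
  change (f : LInfty 1) (fun _ => m 0) = (g : LInfty 1) (fun _ => m 0) at h
  rwa [e] at h

/-- The algebraic tensor product embeds into `ℓ^∞(ℕ₀^k)`. -/
theorem tensorToFun_injective (k : ℕ) : Function.Injective (tensorToFun k) := by
  classical
  rw [injective_iff_map_eq_zero]
  intro x hx
  set b := Module.Basis.ofVectorSpace ℂ (Cbu 1) with hb
  set B := Basis.piTensorProduct (fun _ : Fin k => b) with hB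
  have hu : LinearIndependent ℂ (fun q => coordFun (b q)) :=
    b.linearIndependent.map' _ (LinearMap.ker_eq_bot.2 coordFun_injective)
  set S := (B.repr x).support.biUnion (fun p => Finset.univ.image p) with hS
  have hsub : (B.repr x).support ⊆ Fintype.piFinset (fun _ : Fin k => S) := by
    intro p hp
    rw [Fintype.mem_piFinset]
    intro j
    rw [hS, Finset.mem_biUnion]
    exact ⟨p, hp, Finset.mem_image_of_mem _ (Finset.mem_univ j)⟩
  have hsum : x = ∑ p ∈ Fintype.piFinset (fun _ : Fin k => S), B.repr x p • B p := by
    conv_lhs => rw [← B.linearCombination_repr x, Finsupp.linearCombination_apply, Finsupp.sum]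
    exact Finset.sum_subset hsub fun p _ hp => by
      rw [Finsupp.notMem_support_iff.1 hp, zero_smul]
  have hz := prod_independent hu S k (fun p => B.repr x p) (fun y => by
    have h0 : tensorToFun k x y = 0 := by rw [hx]; rfl
    rw [hsum, map_sum, BoundedContinuousFunction.sum_apply] at h0
    rw [← h0]
    refine Finset.sum_congr rfl fun p _ => ?_
    rw [map_smul, hB, Basis.piTensorProduct_apply, BoundedContinuousFunction.smul_apply,
      tensorToFun_tprod_apply, smul_eq_mul]
    rfl)
  rw [hsum]
  exact Finset.sum_eq_zero fun p hp => by rw [hz p hp, zero_smul]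

/-! ### Symbols -/

/-- Lebesgue measure on `ℝ₊^k`, where `ℝ₊ = (0, ∞)`. -/
def orthantMeasure (k : ℕ) : Measure (Fin k → ℝ) :=
  volume.restrict {r | ∀ j, 0 < r j}

/-- Lebesgue measure on `ℝ₊ = (0, ∞)`. -/
def halfLineMeasure : Measure ℝ := volume.restrict (Set.Ioi 0)

/-- The algebraic tensor product `L^∞(ℝ₊) ⊗ ⋯ ⊗ L^∞(ℝ₊)` (`k` factors) inside `L^∞(ℝ₊^k)`: the
linear span of the functions `r ↦ b₁(r₁) ⋯ b_k(r_k)` with `b_j ∈ L^∞(ℝ₊)`. -/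
def tensorSymbols (k : ℕ) : Submodule ℂ (Lp ℂ ∞ (orthantMeasure k)) :=
  Submodule.span ℂ {a | ∃ b : Fin k → Lp ℂ ∞ halfLineMeasure,
    a =ᵐ[orthantMeasure k] fun r => ∏ j, b j (r j)}

/-! ### Toeplitz operators and their eigenvalue functions -/

/-- The Gaussian measure `dλ(z) = π^{-d} e^{-|z|²} dz` on `ℂ^ι`, where `d` is the cardinality
of `ι`. -/
def fockMeasure (ι : Type) [Fintype ι] : Measure (ι → ℂ) :=
  volume.withDensity fun z =>
    ENNReal.ofReal ((Real.pi ^ Fintype.card ι)⁻¹ * Real.exp (-∑ i, ‖z i‖ ^ 2))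

/-- The reproducing kernel `K_z(w) = e^{⟨w, z⟩}`, with `⟨w, z⟩ = ∑ w_i conj(z_i)`, of the Fock
space on `ℂ^ι`. -/
def fockKernel {ι : Type} [Fintype ι] (z w : ι → ℂ) : ℂ :=
  Complex.exp (∑ i, w i * star (z i))

/-- The Toeplitz operator with symbol `φ` on the Fock space,
`T_φ f(z) = P(φ f)(z) = ∫ φ(w) f(w) conj(K_z(w)) dλ(w)`. -/
def toeplitz {ι : Type} [Fintype ι] (φ f : (ι → ℂ) → ℂ) (z : ι → ℂ) : ℂ :=
  ∫ w, φ w * f w * star (fockKernel z w) ∂(fockMeasure ι)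

/-- Coordinates on `ℂ^n = ℂ^{n_1} × ⋯ × ℂ^{n_k}`, `n = n_1 + ⋯ + n_k`: the index `⟨j, i⟩` is the
`i`-th coordinate of the block `z_{(j)} ∈ ℂ^{n_j}`. -/
abbrev BlockIndex {k : ℕ} (n : Fin k → ℕ) : Type := Σ j : Fin k, Fin (n j)

/-- The Euclidean norm `|z_{(j)}|` of the `j`-th block. -/
def blockNorm {k : ℕ} {n : Fin k → ℕ} (z : BlockIndex n → ℂ) (j : Fin k) : ℝ :=
  Real.sqrt (∑ i, ‖z ⟨j, i⟩‖ ^ 2)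

/-- The `k`-quasi-radial function `φ(z) = a(|z_{(1)}|, …, |z_{(k)}|)` on `ℂ^n`. -/
def quasiRadial {k : ℕ} (n : Fin k → ℕ) (a : (Fin k → ℝ) → ℂ) (z : BlockIndex n → ℂ) : ℂ :=
  a (blockNorm z)

/-- The space `P^{m_1}(ℂ^{n_1}) ⊗ ⋯ ⊗ P^{m_k}(ℂ^{n_k})` of the polynomial functions on `ℂ^n` that
are homogeneous of degree `m_j` in the block `z_{(j)}`, for every `j`. -/
def multiHomogeneous {k : ℕ} (n m : Fin k → ℕ) : Set ((BlockIndex n → ℂ) → ℂ) :=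
  {f | ∃ p : MvPolynomial (BlockIndex n) ℂ,
    p.IsWeightedHomogeneous (fun i : BlockIndex n => (Pi.single i.1 1 : Fin k → ℕ)) m ∧
    f = fun z => MvPolynomial.eval z p}

/-- `γ` is the eigenvalue function `γ_{n,a}` of the Toeplitz operator `T_{n,a}` with the
quasi-radial symbol given by `a`: for every `m ∈ ℕ₀^k`, the operator `T_{n,a}` is the scalar `γ(m)`
on `P^{m_1}(ℂ^{n_1}) ⊗ ⋯ ⊗ P^{m_k}(ℂ^{n_k})`. -/
def IsEigenvalueFunction {k : ℕ} (n : Fin k → ℕ) (a : (Fin k → ℝ) → ℂ)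
    (γ : (Fin k → ℕ) → ℂ) : Prop :=
  ∀ m : Fin k → ℕ, ∀ f ∈ multiHomogeneous n m,
    toeplitz (quasiRadial n a) f = fun z => γ m * f z

/-- The set `𝔊̃_n = {γ_{n,a} | a ∈ L^∞(ℝ₊) ⊗ ⋯ ⊗ L^∞(ℝ₊)}`. -/
def tensorEigenvalueFunctions {k : ℕ} (n : Fin k → ℕ) : Set (LInfty k) :=
  {γ | ∃ a ∈ tensorSymbols k, IsEigenvalueFunction n a γ}

end QuasiRadial
end

/-!
Write `p_N(s) = s^N e^{-s} / N!` on `(0, ∞)` for the Gamma density of shape `N + 1`. The Toeplitz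
operator with a product symbol `b₁(|z_{(1)}|) ⋯ b_k(|z_{(k)}|)` acts on polynomials that are
homogeneous of degree `m_j` in `z_{(j)}` as the scalar
`∏ j, ∫ b_j(√s) p_{m_j + n_j - 1}(s) ds` (`isEigenvalueFunction_prod`). For one complex coordinate
this is an integral in polar coordinates (`integral_mul_fockFactor`); the coordinates of a block are
joined by the convolution identity `p_M ⋆ p_N = p_{M + N + 1}`, and the blocks by Fubini. Symbols
only matter up to null sets because `z ↦ (|z_{(j)}|)_j` pulls null sets back to null sets
(`quasiMeasurePreserving_blockNorm`).

In one variable, `‖p_{N + 1} - p_N‖₁ ≤ (N + 1)^{-1/2}`, so the sequence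
`m ↦ ∫ b(√s) p_{m + d}(s) ds` is Lipschitz for the square-root metric, which gives the inclusion.

For density, let `σ` be bounded and uniformly continuous for the square-root metric. If `S` has
density `p_N`, then `√S - √N` converges in law, even in `L¹` of densities
(`tendsto_integral_abs_rootDensity_sub`), to the centred normal law of variance `1/4`. So the
eigenvalue at a large `m` is nearly the Gaussian mean of `b` around `√m`. The Fourier transform of
the Gaussian `h` has no zeros, so there are integrable `k` for which `h ⋆ k` is an approximate
identity (`exists_deconvolution_kernel`), and `b = f ⋆ k` with `f(x) = σ(⌊x²⌋)` yields a sequence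
close to `σ` outside a finite set. The finitely many remaining terms are corrected with the
indicators of points, which are limits of linear combinations of geometric sequences `m ↦ q^m`, the
eigenvalues of exponential symbols (`approximable_single`). Finally, products depend continuously on
their factors, and the eigenvalue functions form a linear space, so one-variable density implies
density in the tensor product.
-/

noncomputable section

namespace QuasiRadial

/-! ### Gamma densities -/

/-- The density `s ↦ s^N e^{-s} / N!` of the Gamma distribution with shape `N + 1` on `(0, ∞)`,
extended by zero to the real line. -/
def gammaDensity (N : ℕ) (s : ℝ) : ℝ :=
  (Set.Ioi 0).indicator (fun s => s ^ N * Real.exp (-s) / N.factorial) s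

theorem gammaDensity_of_pos {N : ℕ} {s : ℝ} (hs : 0 < s) :
    gammaDensity N s = s ^ N * Real.exp (-s) / N.factorial :=
  Set.indicator_of_mem (show s ∈ Set.Ioi 0 from hs) _

theorem gammaDensity_of_nonpos {N : ℕ} {s : ℝ} (hs : s ≤ 0) : gammaDensity N s = 0 :=
  Set.indicator_of_notMem (show s ∉ Set.Ioi 0 from not_lt.2 hs) _

theorem gammaDensity_nonneg (N : ℕ) (s : ℝ) : 0 ≤ gammaDensity N s := by
  rcases lt_or_ge 0 s with hs | hs
  · rw [gammaDensity_of_pos hs]; positivity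
  · rw [gammaDensity_of_nonpos hs]

theorem measurable_gammaDensity (N : ℕ) : Measurable (gammaDensity N) :=
  Measurable.indicator (by fun_prop) measurableSet_Ioi

theorem integral_pow_mul_exp_neg (N : ℕ) {c : ℝ} (hc : 0 < c) :
    ∫ s in Set.Ioi (0 : ℝ), s ^ N * Real.exp (-(c * s)) = N.factorial / c ^ (N + 1) := by
  have h := Real.integral_rpow_mul_exp_neg_mul_Ioi (a := (N : ℝ) + 1) (r := c) (by positivity) hc
  rw [Real.Gamma_nat_eq_factorial, add_sub_cancel_right] at h
  simp only [Real.rpow_natCast] at h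
  rw [h, show (N : ℝ) + 1 = ((N + 1 : ℕ) : ℝ) by push_cast; ring, Real.rpow_natCast, one_div,
    inv_pow, div_eq_inv_mul]

theorem integrableOn_pow_mul_exp_neg (N : ℕ) {c : ℝ} (hc : 0 < c) :
    IntegrableOn (fun s : ℝ => s ^ N * Real.exp (-(c * s))) (Set.Ioi 0) := by
  by_contra h
  have h1 := integral_pow_mul_exp_neg N hc
  rw [integral_undef h] at h1
  have : 0 < (N.factorial : ℝ) / c ^ (N + 1) := by positivity
  linarith

theorem integrable_gammaDensity (N : ℕ) : Integrable (gammaDensity N) := by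
  refine IntegrableOn.integrable_indicator ?_ measurableSet_Ioi
  simpa [IntegrableOn] using (integrableOn_pow_mul_exp_neg N one_pos).div_const (N.factorial : ℝ)

theorem integral_gammaDensity (N : ℕ) : ∫ s, gammaDensity N s = 1 := by
  have h := integral_pow_mul_exp_neg N one_pos
  simp only [one_mul, one_pow, div_one] at h
  simp only [gammaDensity]
  rw [integral_indicator measurableSet_Ioi, integral_div, h, div_self]
  positivity

theorem mul_gammaDensity (N : ℕ) (s : ℝ) :
    s * gammaDensity N s = (N + 1) * gammaDensity (N + 1) s := by
  rcases lt_or_ge 0 s with hs | hs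
  · rw [gammaDensity_of_pos hs, gammaDensity_of_pos hs, Nat.factorial_succ]
    push_cast
    field_simp
    ring
  · rw [gammaDensity_of_nonpos hs, gammaDensity_of_nonpos hs]; simp

theorem sq_mul_gammaDensity (N : ℕ) (s : ℝ) :
    s ^ 2 * gammaDensity N s = (N + 1) * (N + 2) * gammaDensity (N + 2) s := by
  rw [pow_two, mul_assoc, mul_gammaDensity, mul_left_comm, mul_gammaDensity]
  push_cast
  ring

/-- Consecutive Gamma densities are close in `L¹`: the distance is the mean absolute deviation
of the Gamma distribution divided by its mean, which the variance bounds. -/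
theorem integral_abs_gammaDensity_sub_succ (N : ℕ) :
    ∫ s, |gammaDensity (N + 1) s - gammaDensity N s| ≤ 1 / Real.sqrt (N + 1) := by
  have hN : (0 : ℝ) < N + 1 := by positivity
  set q := Real.sqrt (N + 1) with hq
  have hq0 : 0 < q := Real.sqrt_pos.2 hN
  have hqq : q ^ 2 = N + 1 := Real.sq_sqrt hN.le
  -- `|x| ≤ (x² / q + q) / 2` with `x = s - (N + 1)`, multiplied by the density
  have key : ∀ s, |gammaDensity (N + 1) s - gammaDensity N s| ≤
      (1 / (2 * q * (N + 1))) * ((N + 1) * (N + 2) * gammaDensity (N + 2) s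
        - 2 * (N + 1) * ((N + 1) * gammaDensity (N + 1) s) + ((N + 1) ^ 2 + (N + 1)) *
          gammaDensity N s) := by
    intro s
    rw [← sq_mul_gammaDensity, ← mul_gammaDensity]
    have e : gammaDensity (N + 1) s - gammaDensity N s
        = (s - (N + 1)) / (N + 1) * gammaDensity N s := by
      have := mul_gammaDensity N s
      field_simp
      linarith
    rw [e, abs_mul, abs_of_nonneg (gammaDensity_nonneg N s), abs_div, abs_of_pos hN]
    have h1 : |s - (N + 1)| ≤ ((s - (N + 1)) ^ 2 + q ^ 2) / (2 * q) := by
      rw [le_div_iff₀ (by positivity), ← sq_abs (s - (N + 1))]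
      nlinarith [sq_nonneg (|s - (N + 1)| - q)]
    have h2 : |s - (N + 1)| / (N + 1) * gammaDensity N s
        ≤ ((s - (N + 1)) ^ 2 + q ^ 2) / (2 * q) / (N + 1) * gammaDensity N s := by
      have := gammaDensity_nonneg N s
      gcongr
    refine h2.trans (le_of_eq ?_)
    rw [hqq]
    field_simp
    ring
  have i0 := integrable_gammaDensity N
  have i1 := integrable_gammaDensity (N + 1)
  have i2 := integrable_gammaDensity (N + 2)
  have A : Integrable fun s => ((N : ℝ) + 1) * (N + 2) * gammaDensity (N + 2) s :=
    i2.const_mul _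
  have B : Integrable fun s => 2 * ((N : ℝ) + 1) * ((N + 1) * gammaDensity (N + 1) s) :=
    (i1.const_mul _).const_mul _
  have D : Integrable fun s => (((N : ℝ) + 1) ^ 2 + (N + 1)) * gammaDensity N s :=
    i0.const_mul _
  refine (integral_mono (i1.sub i0).abs (((A.sub B).add D).const_mul _) key).trans (le_of_eq ?_)
  rw [integral_const_mul]
  erw [integral_add (A.sub B) D, integral_sub A B]
  simp only [integral_const_mul, integral_gammaDensity]
  field_simp
  ring

theorem integral_pow_mul_sub_pow (M N : ℕ) {u : ℝ} (hu : 0 < u) :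
    ∫ t in (0 : ℝ)..u, t ^ M * (u - t) ^ N =
      u ^ (M + N + 1) * (M.factorial * N.factorial / (M + N + 1).factorial) := by
  have h := Complex.betaIntegral_scaled (M + 1) (N + 1) hu
  have hb := Complex.Gamma_mul_Gamma_eq_betaIntegral (s := (M : ℂ) + 1) (t := (N : ℂ) + 1)
    (by simp; positivity) (by simp; positivity)
  rw [show (M : ℂ) + 1 + (N + 1) = ((M + N + 1 : ℕ) : ℂ) + 1 by push_cast; ring,
    Complex.Gamma_nat_eq_factorial, Complex.Gamma_nat_eq_factorial,
    Complex.Gamma_nat_eq_factorial] at hb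
  have hne : ((M + N + 1).factorial : ℂ) ≠ 0 :=
    Nat.cast_ne_zero.2 (Nat.factorial_ne_zero _)
  have hb' : Complex.betaIntegral ((M : ℂ) + 1) (N + 1)
      = M.factorial * N.factorial / (M + N + 1).factorial := by
    rw [hb, mul_div_cancel_left₀ _ hne]
  rw [hb', show (M : ℂ) + 1 + (N + 1) - 1 = ((M + N + 1 : ℕ) : ℂ) by push_cast; ring,
    Complex.cpow_natCast, add_sub_cancel_right, add_sub_cancel_right] at h
  simp only [Complex.cpow_natCast] at h
  apply Complex.ofReal_injective
  rw [← intervalIntegral.integral_ofReal]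
  push_cast
  exact h

/-- Gamma distributions of shapes `M + 1` and `N + 1` convolve to the one of shape `M + N + 2`. -/
theorem gammaDensity_convolution (M N : ℕ) (u : ℝ) :
    ∫ t, gammaDensity M t * gammaDensity N (u - t) = gammaDensity (M + N + 1) u := by
  rcases lt_or_ge 0 u with hu | hu
  · have e : ∀ t, t ≠ u → gammaDensity M t * gammaDensity N (u - t)
        = (Set.Ioc 0 u).indicator (fun t => Real.exp (-u) / (M.factorial * N.factorial) *
          (t ^ M * (u - t) ^ N)) t := by
      intro t htu
      by_cases ht : t ∈ Set.Ioc 0 u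
      · rw [Set.indicator_of_mem ht, gammaDensity_of_pos ht.1,
          gammaDensity_of_pos (sub_pos.2 (lt_of_le_of_ne ht.2 htu)),
          show Real.exp (-u) = Real.exp (-t) * Real.exp (-(u - t)) by rw [← Real.exp_add]; ring_nf]
        field_simp
      · rw [Set.indicator_of_notMem ht]
        rcases lt_or_ge 0 t with h0 | h0
        · rw [gammaDensity_of_nonpos (s := u - t), mul_zero]
          have := not_and.1 ht h0
          linarith
        · rw [gammaDensity_of_nonpos h0, zero_mul]
    have ae : ∀ᵐ t : ℝ, gammaDensity M t * gammaDensity N (u - t)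
        = (Set.Ioc 0 u).indicator (fun t => Real.exp (-u) / (M.factorial * N.factorial) *
          (t ^ M * (u - t) ^ N)) t := by
      filter_upwards [compl_mem_ae_iff.2 (measure_singleton u)] with t ht
      exact e t ht
    rw [integral_congr_ae ae, integral_indicator measurableSet_Ioc, integral_const_mul,
      ← intervalIntegral.integral_of_le hu.le, integral_pow_mul_sub_pow M N hu,
      gammaDensity_of_pos hu]
    field_simp
  · rw [gammaDensity_of_nonpos hu]
    refine integral_eq_zero_of_ae (.of_forall fun t => ?_)
    rcases lt_or_ge 0 t with h0 | h0
    · simp [gammaDensity_of_nonpos (N := N) (show u - t ≤ 0 by linarith)]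
    · simp [gammaDensity_of_nonpos (N := M) h0]

/-- The mean of `b` with respect to the Gamma distribution of shape `N + 1`. -/
def gammaMean (N : ℕ) (b : ℝ → ℂ) : ℂ := ∫ s, b s * (gammaDensity N s : ℂ)

/-- Boundedness by a constant, together with measurability: the representatives of elements of
`L^∞` for which everything is defined pointwise. -/
structure BddMeasurable {X : Type*} [MeasurableSpace X] (b : X → ℂ) (C : ℝ) : Prop where
  measurable : Measurable b
  bound : ∀ x, ‖b x‖ ≤ C

theorem BddMeasurable.comp {X Y : Type*} [MeasurableSpace X] [MeasurableSpace Y] {b : X → ℂ}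
    {C : ℝ} (hb : BddMeasurable b C) {f : Y → X} (hf : Measurable f) :
    BddMeasurable (fun y => b (f y)) C :=
  ⟨hb.measurable.comp hf, fun y => hb.bound (f y)⟩

theorem BddMeasurable.integrable_mul {X : Type*} [MeasurableSpace X] {μ : Measure X} {b : X → ℂ}
    {C : ℝ} (hb : BddMeasurable b C) {g : X → ℂ} (hg : Integrable g μ) :
    Integrable (fun x => b x * g x) μ :=
  hg.bdd_mul hb.measurable.aestronglyMeasurable (.of_forall hb.bound)

theorem integrable_mul_gammaDensity {b : ℝ → ℂ} {C : ℝ} (hb : BddMeasurable b C) (N : ℕ) :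
    Integrable (fun s => b s * (gammaDensity N s : ℂ)) :=
  hb.integrable_mul (integrable_gammaDensity N).ofReal

theorem norm_gammaMean_le {b : ℝ → ℂ} {C : ℝ} (hb : BddMeasurable b C) (N : ℕ) :
    ‖gammaMean N b‖ ≤ C := by
  refine (norm_integral_le_integral_norm _).trans ?_
  calc ∫ s, ‖b s * (gammaDensity N s : ℂ)‖ ≤ ∫ s, C * gammaDensity N s := by
        refine integral_mono (integrable_mul_gammaDensity hb N).norm
          ((integrable_gammaDensity N).const_mul C) fun s => ?_
        simp only [norm_mul, Complex.norm_real, Real.norm_eq_abs,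
          abs_of_nonneg (gammaDensity_nonneg N s)]
        exact mul_le_mul_of_nonneg_right (hb.bound s) (gammaDensity_nonneg N s)
    _ = C := by rw [integral_const_mul, integral_gammaDensity, mul_one]

theorem norm_gammaMean_succ_sub_le {b : ℝ → ℂ} {C : ℝ} (hb : BddMeasurable b C) (N : ℕ) :
    ‖gammaMean (N + 1) b - gammaMean N b‖ ≤ C / Real.sqrt (N + 1) := by
  have hC : 0 ≤ C := (norm_nonneg _).trans (hb.bound 0)
  rw [gammaMean, gammaMean, ← integral_sub (integrable_mul_gammaDensity hb _)
    (integrable_mul_gammaDensity hb _)]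
  refine (norm_integral_le_integral_norm _).trans ?_
  have i := ((integrable_gammaDensity (N + 1)).sub (integrable_gammaDensity N)).abs
  calc _ ≤ ∫ s, C * |gammaDensity (N + 1) s - gammaDensity N s| := by
        refine integral_mono ((integrable_mul_gammaDensity hb _).sub
          (integrable_mul_gammaDensity hb _)).norm (i.const_mul C) fun s => ?_
        simp only [← mul_sub, ← Complex.ofReal_sub, norm_mul, Complex.norm_real, Real.norm_eq_abs]
        exact mul_le_mul_of_nonneg_right (hb.bound s) (abs_nonneg _)
    _ ≤ C * (1 / Real.sqrt (N + 1)) := by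
        rw [integral_const_mul]
        exact mul_le_mul_of_nonneg_left (integral_abs_gammaDensity_sub_succ N) hC
    _ = _ := by ring

theorem bddMeasurable_gammaMean_add {b : ℝ → ℂ} {C : ℝ} (hb : BddMeasurable b C) (N : ℕ) :
    BddMeasurable (fun t => gammaMean N fun s => b (t + s)) C := by
  refine ⟨?_, fun t => norm_gammaMean_le (hb.comp (measurable_const_add t)) N⟩
  have : StronglyMeasurable fun p : ℝ × ℝ => b (p.1 + p.2) * (gammaDensity N p.2 : ℂ) := by
    refine Measurable.stronglyMeasurable ?_
    have h1 := hb.measurable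
    have h2 := measurable_gammaDensity N
    fun_prop
  exact (this.integral_prod_right).measurable

/-- The mean with respect to the sum of two independent Gamma variables. -/
theorem gammaMean_gammaMean_add {b : ℝ → ℂ} {C : ℝ} (hb : BddMeasurable b C) (M N : ℕ) :
    (gammaMean M fun t => gammaMean N fun s => b (t + s)) = gammaMean (M + N + 1) b := by
  have e : ∀ t, (gammaMean N fun s => b (t + s)) = ∫ u, b u * (gammaDensity N (u - t) : ℂ) := by
    intro t
    rw [gammaMean, ← integral_sub_right_eq_self _ t]
    simp
  have hint : Integrable (fun p : ℝ × ℝ => b p.1 * ((gammaDensity M p.2 : ℂ) *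
      (gammaDensity N (p.1 - p.2) : ℂ))) (volume.prod volume) :=
    (hb.comp measurable_fst).integrable_mul
      ((integrable_gammaDensity M).ofReal.convolution_integrand (ContinuousLinearMap.mul ℂ ℂ)
        (integrable_gammaDensity N).ofReal)
  calc (gammaMean M fun t => gammaMean N fun s => b (t + s))
      = ∫ t, ∫ u, b u * ((gammaDensity M t : ℂ) * (gammaDensity N (u - t) : ℂ)) := by
        refine integral_congr_ae (.of_forall fun t => ?_)
        simp only [e, ← integral_mul_const]
        refine integral_congr_ae (.of_forall fun u => ?_)
        ring
    _ = ∫ u, ∫ t, b u * ((gammaDensity M t : ℂ) * (gammaDensity N (u - t) : ℂ)) :=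
        (integral_integral_swap hint).symm
    _ = gammaMean (M + N + 1) b := by
        refine integral_congr_ae (.of_forall fun u => ?_)
        simp only [integral_const_mul, ← Complex.ofReal_mul]
        rw [integral_complex_ofReal, gammaDensity_convolution]

/-! ### Gaussian integrals over a single complex coordinate -/

/-- The contribution of a single coordinate `w` to the Toeplitz integrand of the monomial of
exponent `α`: Gaussian weight times `w^α` times the conjugate of the reproducing kernel at `z`. -/
def fockFactor (α : ℕ) (z w : ℂ) : ℂ :=
  ((Real.pi⁻¹ * Real.exp (-‖w‖ ^ 2) : ℝ) : ℂ) * (w ^ α * Complex.exp (star w * z))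

theorem continuous_fockFactor (α : ℕ) (z : ℂ) : Continuous (fockFactor α z) := by
  unfold fockFactor
  fun_prop

theorem pow_mul_exp_mul_exp_neg_sq_le (α : ℕ) (c : ℝ) {x : ℝ} (hx : 0 ≤ x) :
    x ^ α * Real.exp (x * c) * Real.exp (-x ^ 2) ≤
      α.factorial * Real.exp ((c + 1) ^ 2 / 2) * Real.exp (-(1 / 2) * x ^ 2) := by
  have h1 : x ^ α ≤ α.factorial * Real.exp x := by
    have := Real.pow_div_factorial_le_exp x hx α
    rwa [div_le_iff₀' (by positivity)] at this
  calc _ ≤ α.factorial * Real.exp x * Real.exp (x * c) * Real.exp (-x ^ 2) := by gcongr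
    _ = α.factorial * Real.exp (x + x * c + -x ^ 2) := by
      rw [Real.exp_add, Real.exp_add]; ring
    _ ≤ α.factorial * Real.exp ((c + 1) ^ 2 / 2 + -(1 / 2) * x ^ 2) := by
      refine mul_le_mul_of_nonneg_left (Real.exp_le_exp.2 ?_) (by positivity)
      nlinarith [sq_nonneg (x - (c + 1))]
    _ = _ := by rw [Real.exp_add]; ring

theorem norm_fockFactor_le (α : ℕ) (z w : ℂ) :
    ‖fockFactor α z w‖ ≤ Real.pi⁻¹ * (α.factorial * Real.exp ((‖z‖ + 1) ^ 2 / 2) *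
      Real.exp (-(1 / 2) * ‖w‖ ^ 2)) := by
  have h := pow_mul_exp_mul_exp_neg_sq_le α ‖z‖ (norm_nonneg w)
  have h2 : ‖Complex.exp (star w * z)‖ ≤ Real.exp (‖w‖ * ‖z‖) := by
    refine (Complex.norm_exp_le_exp_norm _).trans (le_of_eq ?_)
    rw [norm_mul, norm_star]
  have hpi := Real.pi_pos
  rw [fockFactor, norm_mul, norm_mul, norm_pow, Complex.norm_real, Real.norm_of_nonneg
    (by positivity), mul_assoc]
  refine mul_le_mul_of_nonneg_left (le_trans ?_ h) (by positivity)
  calc _ ≤ Real.exp (-‖w‖ ^ 2) * (‖w‖ ^ α * Real.exp (‖w‖ * ‖z‖)) := by gcongr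
    _ = _ := by ring

theorem integrable_fockFactor (α : ℕ) (z : ℂ) : Integrable (fockFactor α z) := by
  have h := (GaussianFourier.integrable_cexp_neg_mul_sq_norm_add (V := ℂ) (b := 1 / 2)
    (by norm_num) 0 0).norm
  refine ((h.const_mul (α.factorial * Real.exp ((‖z‖ + 1) ^ 2 / 2))).const_mul
    Real.pi⁻¹).mono' (continuous_fockFactor α z).aestronglyMeasurable (.of_forall fun w => ?_)
  refine (norm_fockFactor_le α z w).trans (le_of_eq ?_)
  rw [Complex.norm_exp]
  congr 3
  norm_num [← Complex.ofReal_pow]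

/-- The `α`-th Fourier coefficient of `θ ↦ exp(c e^{-iθ})`. -/
theorem integral_exp_pow_mul_exp (α : ℕ) (c : ℂ) :
    ∫ θ in (-Real.pi)..Real.pi,
      Complex.exp (θ * Complex.I) ^ α * Complex.exp (c * Complex.exp (-(θ * Complex.I))) =
      2 * Real.pi * (c ^ α / α.factorial) := by
  have hF : ∀ θ : ℝ, HasSum (fun m : ℕ => c ^ m / m.factorial *
      Complex.exp (((α : ℂ) - m) * Complex.I * θ))
      (Complex.exp (θ * Complex.I) ^ α * Complex.exp (c * Complex.exp (-(θ * Complex.I)))) := by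
    intro θ
    have h := (NormedSpace.expSeries_div_hasSum_exp
      (c * Complex.exp (-(θ * Complex.I)))).mul_left (Complex.exp (θ * Complex.I) ^ α)
    rw [← Complex.exp_eq_exp_ℂ] at h
    refine h.congr_fun ?_
    intro m
    rw [mul_pow, ← Complex.exp_nat_mul, ← Complex.exp_nat_mul,
      show ((α : ℂ) - m) * Complex.I * θ = α * (θ * Complex.I) + m * -(θ * Complex.I) by ring,
      Complex.exp_add]
    ring
  have hs : Summable fun m : ℕ => ‖c‖ ^ m / m.factorial := Real.summable_pow_div_factorial ‖c‖
  have h := intervalIntegral.hasSum_integral_of_dominated_convergence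
    (μ := volume) (a := -Real.pi) (b := Real.pi)
    (F := fun (m : ℕ) (θ : ℝ) => c ^ m / m.factorial *
      Complex.exp (((α : ℂ) - m) * Complex.I * θ))
    (fun m _ => ‖c‖ ^ m / m.factorial)
    (fun m => (by fun_prop : Continuous fun θ : ℝ => c ^ m / m.factorial *
      Complex.exp (((α : ℂ) - m) * Complex.I * θ)).aestronglyMeasurable)
    (fun m => .of_forall fun θ _ => by
      rw [norm_mul, norm_div, norm_pow, Complex.norm_natCast,
        show ((α : ℂ) - m) * Complex.I * θ = (((α - m : ℝ) * θ : ℝ) : ℂ) * Complex.I by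
          push_cast; ring, Complex.norm_exp_ofReal_mul_I, mul_one])
    (.of_forall fun _ _ => hs) (by simp)
    (.of_forall fun θ _ => hF θ)
  refine h.unique ?_
  have hz : ∀ m : ℕ, m ≠ α → ∫ θ in (-Real.pi)..Real.pi, c ^ m / m.factorial *
      Complex.exp (((α : ℂ) - m) * Complex.I * θ) = 0 := by
    intro m hm
    have hne : ((α : ℂ) - m) * Complex.I ≠ 0 :=
      mul_ne_zero (sub_ne_zero.2 (by exact_mod_cast hm.symm)) Complex.I_ne_zero
    rw [intervalIntegral.integral_const_mul, integral_exp_mul_complex hne,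
      show ((α : ℂ) - m) * Complex.I * (Real.pi : ℝ) = ((α : ℂ) - m) * Complex.I * (-Real.pi : ℝ)
        + ((α - m : ℤ) : ℂ) * (2 * Real.pi * Complex.I) by push_cast; ring,
      Complex.exp_add, Complex.exp_int_mul_two_pi_mul_I]
    simp
  have e : (2 * Real.pi * (c ^ α / α.factorial) : ℂ) = ∫ θ in (-Real.pi)..Real.pi,
      c ^ α / α.factorial * Complex.exp (((α : ℂ) - α) * Complex.I * θ) := by
    simp
    ring
  rw [e]
  exact hasSum_single α hz

theorem integral_comp_sq_Ioi (g : ℝ → ℂ) :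
    ∫ r in Set.Ioi (0 : ℝ), ((2 * r : ℝ) : ℂ) * g (r ^ 2) = ∫ s in Set.Ioi (0 : ℝ), g s := by
  rw [← integral_comp_rpow_Ioi g two_ne_zero]
  refine setIntegral_congr_fun measurableSet_Ioi fun r _ => ?_
  norm_num [Real.rpow_two]

theorem gammaMean_eq_setIntegral (N : ℕ) (b : ℝ → ℂ) :
    gammaMean N b = ∫ s in Set.Ioi (0 : ℝ),
      b s * ((s ^ N * Real.exp (-s) / N.factorial : ℝ) : ℂ) := by
  rw [gammaMean, ← integral_indicator measurableSet_Ioi]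
  refine integral_congr_ae (.of_forall fun s => ?_)
  by_cases hs : 0 < s
  · simp only [gammaDensity_of_pos hs, Set.indicator_of_mem (show s ∈ Set.Ioi 0 from hs)]
  · rw [Set.indicator_of_notMem (show s ∉ Set.Ioi 0 from hs)]
    simp only [gammaDensity_of_nonpos (not_lt.1 hs), Complex.ofReal_zero, mul_zero]

/-- In polar coordinates, the angular integral turns the monomial into its value at `z`, and the
radial integral is a Gamma mean in the variable `s = |w|²`. -/
theorem integral_mul_fockFactor {b : ℝ → ℂ} {C : ℝ} (hb : BddMeasurable b C) (α : ℕ) (z : ℂ) :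
    ∫ w, b (‖w‖ ^ 2) * fockFactor α z w = z ^ α * gammaMean α b := by
  have hpi := Real.pi_pos
  rw [← Complex.integral_comp_polarCoord_symm, polarCoord_target]
  set G : ℝ × ℝ → ℂ := fun p => p.1 • (b (‖Complex.polarCoord.symm p‖ ^ 2) *
    fockFactor α z (Complex.polarCoord.symm p)) with hG
  have hmeas : Measurable fun p : ℝ × ℝ => Complex.polarCoord.symm p := by
    simp only [Complex.polarCoord_symm_apply]
    fun_prop
  have hint : IntegrableOn G (Set.Ioi 0 ×ˢ Set.Ioo (-Real.pi) Real.pi) (volume.prod volume) := by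
    have hK : IntegrableOn (fun p : ℝ × ℝ => C * (Real.pi⁻¹ * (α.factorial *
        Real.exp ((‖z‖ + 1) ^ 2 / 2))) * (p.1 * Real.exp (-(1 / 2) * p.1 ^ 2)) * 1)
        (Set.Ioi 0 ×ˢ Set.Ioo (-Real.pi) Real.pi) (volume.prod volume) := by
      rw [IntegrableOn, ← Measure.prod_restrict]
      refine Integrable.mul_prod (f := fun r : ℝ => C * (Real.pi⁻¹ * (α.factorial *
        Real.exp ((‖z‖ + 1) ^ 2 / 2))) * (r * Real.exp (-(1 / 2) * r ^ 2)))
        (g := fun _ : ℝ => (1 : ℝ)) ?_ ?_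
      · exact ((integrable_mul_exp_neg_mul_sq (by norm_num)).const_mul _).integrableOn
      · exact integrable_const 1
    refine hK.mono' ?_ ?_
    · refine Measurable.aestronglyMeasurable ?_
      exact measurable_fst.smul ((hb.measurable.comp (hmeas.norm.pow_const 2)).mul
        ((continuous_fockFactor α z).measurable.comp hmeas))
    · refine (ae_restrict_iff' (measurableSet_Ioi.prod measurableSet_Ioo)).2 (.of_forall ?_)
      rintro ⟨r, θ⟩ ⟨hr, -⟩
      have hr : 0 < r := hr
      have hn : ‖Complex.polarCoord.symm (r, θ)‖ = r := by
        rw [Complex.norm_polarCoord_symm, abs_of_pos hr]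
      simp only [hG, norm_smul, norm_mul, Real.norm_of_nonneg hr.le]
      have h1 := norm_fockFactor_le α z (Complex.polarCoord.symm (r, θ))
      have h2 := hb.bound (‖Complex.polarCoord.symm (r, θ)‖ ^ 2)
      rw [hn] at h1 h2 ⊢
      calc r * (‖b (r ^ 2)‖ * ‖fockFactor α z (Complex.polarCoord.symm (r, θ))‖)
          ≤ r * (C * (Real.pi⁻¹ * (α.factorial * Real.exp ((‖z‖ + 1) ^ 2 / 2) *
            Real.exp (-(1 / 2) * r ^ 2)))) := by
            have : 0 ≤ C := (norm_nonneg _).trans h2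
            gcongr
        _ = _ := by ring
  rw [Measure.volume_eq_prod, setIntegral_prod _ hint]
  have hinner : ∀ r ∈ Set.Ioi (0 : ℝ), ∫ θ in Set.Ioo (-Real.pi) Real.pi, G (r, θ)
      = ((2 * r : ℝ) : ℂ) * (z ^ α * (b (r ^ 2) *
        (((r ^ 2) ^ α * Real.exp (-r ^ 2) / α.factorial : ℝ) : ℂ))) := by
    intro r hr
    have hr : 0 < r := hr
    have e : ∀ θ : ℝ, G (r, θ) = (r * b (r ^ 2) * (Real.pi⁻¹ * Real.exp (-r ^ 2) : ℝ) * r ^ α) *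
        (Complex.exp (θ * Complex.I) ^ α *
          Complex.exp ((r * z) * Complex.exp (-(θ * Complex.I)))) := by
      intro θ
      have hs : Complex.polarCoord.symm (r, θ) = r * Complex.exp (θ * Complex.I) := by
        rw [Complex.polarCoord_symm_apply, Complex.exp_mul_I, Complex.ofReal_cos,
          Complex.ofReal_sin]
      have hn : ‖Complex.polarCoord.symm (r, θ)‖ = r := by
        rw [Complex.norm_polarCoord_symm, abs_of_pos hr]
      have hst : star (Complex.polarCoord.symm (r, θ)) = r * Complex.exp (-(θ * Complex.I)) := by
        rw [hs, star_mul', Complex.star_def, Complex.conj_ofReal,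
          ← Complex.exp_conj]
        simp
      simp only [hG, fockFactor, hn]
      rw [hst, hs, mul_pow, Complex.real_smul, show (r : ℂ) * Complex.exp (-(θ * Complex.I)) * z
        = (r * z) * Complex.exp (-(θ * Complex.I)) by ring]
      ring
    simp only [e]
    rw [integral_const_mul, ← integral_Ioc_eq_integral_Ioo,
      ← intervalIntegral.integral_of_le (by linarith), integral_exp_pow_mul_exp]
    have : (Real.pi : ℂ) ≠ 0 := by exact_mod_cast hpi.ne'
    push_cast
    field_simp
    ring
  rw [setIntegral_congr_fun measurableSet_Ioi hinner,
    integral_comp_sq_Ioi (fun s => z ^ α * (b s *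
      ((s ^ α * Real.exp (-s) / α.factorial : ℝ) : ℂ))), integral_const_mul,
    gammaMean_eq_setIntegral]

/-! ### Gaussian integrals over blocks of coordinates -/

theorem integrable_prod_fockFactor {ι : Type*} [Fintype ι] (α : ι → ℕ) (z : ι → ℂ) :
    Integrable fun w : ι → ℂ => ∏ i, fockFactor (α i) (z i) (w i) :=
  Integrable.fintype_prod fun i => integrable_fockFactor (α i) (z i)

theorem integral_mul_prod_fockFactor_succ {b : ℝ → ℂ} {C : ℝ} (d : ℕ)
    (hb : BddMeasurable b C) (α : Fin (d + 1) → ℕ) (z : Fin (d + 1) → ℂ) :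
    ∫ w : Fin (d + 1) → ℂ, b (∑ i, ‖w i‖ ^ 2) * ∏ i, fockFactor (α i) (z i) (w i) =
      (∏ i, z i ^ α i) * gammaMean ((∑ i, α i) + d) b := by
  induction d generalizing b with
  | zero =>
    have h := (volume_preserving_funUnique (Fin 1) ℂ).symm.integral_comp
      (MeasurableEquiv.funUnique (Fin 1) ℂ).symm.measurableEmbedding
      (fun w : Fin 1 → ℂ => b (∑ i, ‖w i‖ ^ 2) * ∏ i, fockFactor (α i) (z i) (w i))
    refine h.symm.trans ?_
    simpa using integral_mul_fockFactor hb (α 0) (z 0)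
  | succ d ih =>
    have h := (volume_preserving_piFinSuccAbove (fun _ : Fin (d + 2) => ℂ) 0).symm.integral_comp
      (MeasurableEquiv.piFinSuccAbove (fun _ => ℂ) 0).symm.measurableEmbedding
      (fun w : Fin (d + 2) → ℂ => b (∑ i, ‖w i‖ ^ 2) * ∏ i, fockFactor (α i) (z i) (w i))
    rw [← h]
    have e : ∀ p : ℂ × (Fin (d + 1) → ℂ),
        b (∑ i, ‖(MeasurableEquiv.piFinSuccAbove (fun _ => ℂ) 0).symm p i‖ ^ 2) *
          ∏ i, fockFactor (α i) (z i) ((MeasurableEquiv.piFinSuccAbove (fun _ => ℂ) 0).symm p i)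
        = b (‖p.1‖ ^ 2 + ∑ i, ‖p.2 i‖ ^ 2) * (fockFactor (α 0) (z 0) p.1 *
          ∏ i : Fin (d + 1), fockFactor (α i.succ) (z i.succ) (p.2 i)) := by
      intro p
      simp [Fin.sum_univ_succ (n := d + 1), Fin.prod_univ_succ (n := d + 1),
        MeasurableEquiv.piFinSuccAbove_symm_apply]
    have hm : Measurable fun p : ℂ × (Fin (d + 1) → ℂ) => ‖p.1‖ ^ 2 + ∑ i, ‖p.2 i‖ ^ 2 := by
      fun_prop
    have hint : Integrable (fun p : ℂ × (Fin (d + 1) → ℂ) =>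
        b (‖p.1‖ ^ 2 + ∑ i, ‖p.2 i‖ ^ 2) * (fockFactor (α 0) (z 0) p.1 *
          ∏ i : Fin (d + 1), fockFactor (α i.succ) (z i.succ) (p.2 i)))
        (volume.prod volume) :=
      (hb.comp hm).integrable_mul ((integrable_fockFactor (α 0) (z 0)).mul_prod
        (integrable_prod_fockFactor (fun i : Fin (d + 1) => α i.succ) (fun i => z i.succ)))
    simp only [e]
    rw [Measure.volume_eq_prod, integral_prod _ hint]
    have inner : ∀ w : ℂ, ∫ y : Fin (d + 1) → ℂ, b (‖w‖ ^ 2 + ∑ i, ‖y i‖ ^ 2) *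
        (fockFactor (α 0) (z 0) w *
          ∏ i : Fin (d + 1), fockFactor (α i.succ) (z i.succ) (y i))
        = (∏ i : Fin (d + 1), z i.succ ^ α i.succ) *
          (gammaMean ((∑ i : Fin (d + 1), α i.succ) + d) (fun s => b (‖w‖ ^ 2 + s)) *
            fockFactor (α 0) (z 0) w) := by
      intro w
      have := ih (hb.comp (measurable_const_add (‖w‖ ^ 2))) (fun i => α i.succ)
        (fun i => z i.succ)
      rw [← mul_assoc, ← this, ← integral_mul_const]
      refine integral_congr_ae (.of_forall fun y => ?_)
      ring
    simp only [inner]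
    rw [integral_const_mul, integral_mul_fockFactor
      (bddMeasurable_gammaMean_add hb ((∑ i : Fin (d + 1), α i.succ) + d)),
      gammaMean_gammaMean_add hb, Fin.prod_univ_succ (n := d + 1), Fin.sum_univ_succ (n := d + 1),
      show α 0 + (∑ i : Fin (d + 1), α i.succ + d) + 1
      = α 0 + ∑ i : Fin (d + 1), α i.succ + (d + 1) by ring]
    ring

/-- Under the Gaussian measure weighted by a monomial, the squared norm of a block of `n`
coordinates follows the Gamma distribution whose shape is the degree plus `n`. -/
theorem integral_mul_prod_fockFactor {b : ℝ → ℂ} {C : ℝ} {n : ℕ} (hn : 1 ≤ n)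
    (hb : BddMeasurable b C) (α : Fin n → ℕ) (z : Fin n → ℂ) :
    ∫ w : Fin n → ℂ, b (∑ i, ‖w i‖ ^ 2) * ∏ i, fockFactor (α i) (z i) (w i) =
      (∏ i, z i ^ α i) * gammaMean ((∑ i, α i) + (n - 1)) b := by
  obtain ⟨d, rfl⟩ : ∃ d, n = d + 1 := ⟨n - 1, by omega⟩
  exact integral_mul_prod_fockFactor_succ d hb α z

/-- Grouping coordinates into blocks preserves the volume. -/
theorem volume_preserving_sigmaCurry {k : ℕ} (n : Fin k → ℕ) :
    MeasurePreserving (MeasurableEquiv.piCurry fun (j : Fin k) (_ : Fin (n j)) => ℂ) := by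
  have : MeasurePreserving (MeasurableEquiv.piCurry fun (j : Fin k) (_ : Fin (n j)) => ℂ).symm := by
    refine ⟨MeasurableEquiv.measurable _, ?_⟩
    rw [volume_pi (ι := BlockIndex n)]
    refine (Measure.pi_eq fun s hs => ?_).symm
    rw [MeasurableEquiv.map_apply]
    have e : (MeasurableEquiv.piCurry fun (j : Fin k) (_ : Fin (n j)) => ℂ).symm ⁻¹'
        Set.univ.pi s = Set.univ.pi fun j => Set.univ.pi fun i => s ⟨j, i⟩ := by
      ext w
      simp only [Set.mem_preimage, Set.mem_univ_pi]
      exact ⟨fun h j i => h ⟨j, i⟩, fun h x => h x.1 x.2⟩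
    rw [e, volume_pi, Measure.pi_pi, Fintype.prod_sigma]
    refine Finset.prod_congr rfl fun j _ => ?_
    rw [volume_pi, Measure.pi_pi]
  exact this.symm

theorem integral_prod_blocks {k : ℕ} (n : Fin k → ℕ) (B : ∀ j, (Fin (n j) → ℂ) → ℂ) :
    ∫ w : BlockIndex n → ℂ, ∏ j, B j (fun i => w ⟨j, i⟩) = ∏ j, ∫ y, B j y := by
  rw [← integral_fintype_prod_volume_eq_prod,
    ← (volume_preserving_sigmaCurry n).integral_comp (MeasurableEquiv.measurableEmbedding _)]
  rfl

/-! ### Null sets of radii -/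

theorem quasiMeasurePreserving_prodMap {X Y X' Y' : Type*} [MeasurableSpace X] [MeasurableSpace Y]
    [MeasurableSpace X'] [MeasurableSpace Y'] {μ : Measure X} {ν : Measure Y} {μ' : Measure X'}
    {ν' : Measure Y'} [SFinite μ'] [SFinite ν'] {f : X → Y} {g : X' → Y'}
    (hf : Measure.QuasiMeasurePreserving f μ ν) (hg : Measure.QuasiMeasurePreserving g μ' ν') :
    Measure.QuasiMeasurePreserving (Prod.map f g) (μ.prod μ') (ν.prod ν') := by
  refine ⟨hf.measurable.prodMap hg.measurable, Measure.AbsolutelyContinuous.mk fun s hs h => ?_⟩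
  have hm := hf.measurable.prodMap hg.measurable
  rw [Measure.map_apply hm hs, Measure.measure_prod_null (hm hs)]
  rw [Measure.measure_prod_null hs] at h
  filter_upwards [hf.ae h] with x hx
  exact hg.preimage_null hx

theorem quasiMeasurePreserving_pi {k : ℕ} {X Y : Fin k → Type*} [∀ i, MeasurableSpace (X i)]
    [∀ i, MeasurableSpace (Y i)] {μ : ∀ i, Measure (X i)} {ν : ∀ i, Measure (Y i)}
    [∀ i, SigmaFinite (μ i)] [∀ i, SigmaFinite (ν i)] {f : ∀ i, X i → Y i}
    (hf : ∀ i, Measure.QuasiMeasurePreserving (f i) (μ i) (ν i)) :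
    Measure.QuasiMeasurePreserving (fun x i => f i (x i)) (Measure.pi μ) (Measure.pi ν) := by
  induction k with
  | zero =>
    refine ⟨measurable_pi_iff.2 fun i => i.elim0, ?_⟩
    rw [Measure.pi_of_empty μ (fun i => i.elim0), Measure.pi_of_empty ν (fun i => i.elim0),
      Measure.map_dirac' (measurable_pi_iff.2 fun i => i.elim0)]
    rw [Subsingleton.elim (fun i : Fin 0 => f i _) (fun i => i.elim0)]
  | succ k ih =>
    have hX := measurePreserving_piFinSuccAbove μ 0
    have hY := (measurePreserving_piFinSuccAbove ν 0).symm
    have hmid := quasiMeasurePreserving_prodMap (hf 0) (ih fun i => hf (Fin.succAbove 0 i))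
    have := hY.quasiMeasurePreserving.comp (hmid.comp hX.quasiMeasurePreserving)
    convert! this using 1
    funext x i
    refine Fin.cases ?_ (fun i => ?_) i <;> rfl

theorem gammaMean_eq_integral_sq (N : ℕ) (b : ℝ → ℂ) :
    gammaMean N b = ∫ r in Set.Ioi (0 : ℝ), ((2 * r : ℝ) : ℂ) *
      (b (r ^ 2) * (((r ^ 2) ^ N * Real.exp (-r ^ 2) / N.factorial : ℝ) : ℂ)) := by
  rw [gammaMean_eq_setIntegral, ← integral_comp_sq_Ioi]

/-- The Euclidean norm on `ℂ^n`, `n ≥ 1`, pulls null sets of radii back to null sets: integrate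
the indicator function against the Gaussian weight. -/
theorem quasiMeasurePreserving_norm {n : ℕ} (hn : 1 ≤ n) :
    Measure.QuasiMeasurePreserving (fun w : Fin n → ℂ => Real.sqrt (∑ i, ‖w i‖ ^ 2)) volume
      halfLineMeasure := by
  have hm : Measurable fun w : Fin n → ℂ => Real.sqrt (∑ i, ‖w i‖ ^ 2) := by fun_prop
  refine ⟨hm, Measure.AbsolutelyContinuous.mk fun s hs h => ?_⟩
  rw [Measure.map_apply hm hs]
  have hs' : MeasurableSet (Real.sqrt ⁻¹' s) := Real.continuous_sqrt.measurable hs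
  set b : ℝ → ℂ := (Real.sqrt ⁻¹' s).indicator 1 with hb
  have hbm : BddMeasurable b 1 := by
    refine ⟨measurable_one.indicator hs', fun x => ?_⟩
    by_cases hx : x ∈ Real.sqrt ⁻¹' s <;> simp [hb, hx]
  have h1 := integral_mul_prod_fockFactor hn hbm 0 0
  have h0 : gammaMean ((∑ i : Fin n, (0 : Fin n → ℕ) i) + (n - 1)) b = 0 := by
    rw [gammaMean_eq_integral_sq]
    refine integral_eq_zero_of_ae ?_
    have hae : ∀ᵐ r ∂halfLineMeasure, r ∉ s := compl_mem_ae_iff.2 (by simpa using h)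
    filter_upwards [hae, ae_restrict_mem measurableSet_Ioi] with r hr hr0
    have : r ^ 2 ∉ Real.sqrt ⁻¹' s := by
      rwa [Set.mem_preimage, Real.sqrt_sq (le_of_lt hr0)]
    simp [hb, this]
  rw [h0, mul_zero] at h1
  set W : (Fin n → ℂ) → ℝ := fun w => (Real.sqrt ⁻¹' s).indicator 1 (∑ i, ‖w i‖ ^ 2) *
    ∏ i, (Real.pi⁻¹ * Real.exp (-‖w i‖ ^ 2)) with hW
  have e : ∀ w : Fin n → ℂ, b (∑ i, ‖w i‖ ^ 2) * ∏ i, fockFactor 0 0 (w i) = (W w : ℂ) := by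
    intro w
    by_cases hx : ∑ i, ‖w i‖ ^ 2 ∈ Real.sqrt ⁻¹' s <;> simp [hb, hW, hx, fockFactor]
  have hint : Integrable W := by
    have := hbm.comp (f := fun w : Fin n → ℂ => ∑ i, ‖w i‖ ^ 2) (by fun_prop) |>.integrable_mul
      (integrable_prod_fockFactor (0 : Fin n → ℕ) 0)
    have h2 := this.re
    refine h2.congr (.of_forall fun w => ?_)
    simp only [Pi.zero_apply, e]
    simp
  have hpos : ∀ w, 0 ≤ W w := by
    intro w
    have hpi := Real.pi_pos
    refine mul_nonneg (Set.indicator_nonneg (fun _ _ => zero_le_one) _)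
      (Finset.prod_nonneg fun i _ => by positivity)
  have hzero : ∫ w, W w = 0 := by
    have h3 : ∫ w, (W w : ℂ) = 0 := by
      rw [← h1]
      exact integral_congr_ae (.of_forall fun w => (e w).symm)
    rw [integral_complex_ofReal] at h3
    exact_mod_cast h3
  rw [integral_eq_zero_iff_of_nonneg hpos hint] at hzero
  refine measure_mono_null (fun w hw => ?_) (ae_iff.1 hzero)
  have hpi := Real.pi_pos
  have hw' : ∑ i, ‖w i‖ ^ 2 ∈ Real.sqrt ⁻¹' s := hw
  have : 0 < W w := by
    simp only [hW, Set.indicator_of_mem hw', Pi.one_apply, one_mul]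
    exact Finset.prod_pos fun i _ => by positivity
  exact this.ne'

theorem orthantMeasure_eq_pi (k : ℕ) :
    orthantMeasure k = Measure.pi fun _ : Fin k => halfLineMeasure := by
  rw [orthantMeasure, show {r : Fin k → ℝ | ∀ j, 0 < r j} = Set.univ.pi fun _ => Set.Ioi 0 by
    ext; simp, volume_pi, Measure.restrict_pi_pi]
  rfl

instance : SigmaFinite halfLineMeasure := by
  unfold halfLineMeasure
  infer_instance

theorem quasiMeasurePreserving_blockNorm {k : ℕ} {n : Fin k → ℕ} (hn : ∀ j, 1 ≤ n j) :
    Measure.QuasiMeasurePreserving (fun w : BlockIndex n → ℂ => blockNorm w) volume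
      (orthantMeasure k) := by
  rw [orthantMeasure_eq_pi]
  exact (quasiMeasurePreserving_pi fun j => quasiMeasurePreserving_norm (hn j)).comp
    (volume_preserving_sigmaCurry n).quasiMeasurePreserving

theorem quasiRadial_ae_eq {k : ℕ} {n : Fin k → ℕ} (hn : ∀ j, 1 ≤ n j) {a a' : (Fin k → ℝ) → ℂ}
    (h : a =ᵐ[orthantMeasure k] a') : quasiRadial n a =ᵐ[volume] quasiRadial n a' :=
  (quasiMeasurePreserving_blockNorm hn).ae_eq_comp h

/-! ### The Toeplitz operator on polynomials -/

/-- The Toeplitz integrand of the polynomial `p` without its symbol, as a function with respect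
to Lebesgue measure. -/
def polyWeight {ι : Type} [Fintype ι] (p : MvPolynomial ι ℂ) (z w : ι → ℂ) : ℂ :=
  ∑ α ∈ p.support, p.coeff α * ∏ i, fockFactor (α i) (z i) (w i)

theorem integrable_polyWeight {ι : Type} [Fintype ι] (p : MvPolynomial ι ℂ) (z : ι → ℂ) :
    Integrable (polyWeight p z) :=
  integrable_finsetSum _ fun α _ => (integrable_prod_fockFactor α z).const_mul _

theorem toeplitz_eval {ι : Type} [Fintype ι] (φ : (ι → ℂ) → ℂ) (p : MvPolynomial ι ℂ)
    (z : ι → ℂ) :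
    toeplitz φ (fun w => MvPolynomial.eval w p) z = ∫ w, φ w * polyWeight p z w := by
  rw [toeplitz, fockMeasure, integral_withDensity_eq_integral_toReal_smul (by fun_prop)
    (.of_forall fun _ => ENNReal.ofReal_lt_top)]
  refine integral_congr_ae (.of_forall fun w => ?_)
  have hpi := Real.pi_pos
  have hd : (Real.pi ^ Fintype.card ι)⁻¹ * Real.exp (-∑ i, ‖w i‖ ^ 2)
      = ∏ i, (Real.pi⁻¹ * Real.exp (-‖w i‖ ^ 2)) := by
    rw [Finset.prod_mul_distrib, Finset.prod_const, ← Real.exp_sum, Finset.sum_neg_distrib,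
      inv_pow, Finset.card_univ]
  have hk : star (fockKernel z w) = ∏ i, Complex.exp (star (w i) * z i) := by
    rw [fockKernel, Complex.star_def, ← Complex.exp_conj, map_sum, Complex.exp_sum]
    simp
  simp only
  rw [ENNReal.toReal_ofReal (by positivity), hd, hk, Complex.real_smul, MvPolynomial.eval_eq',
    polyWeight]
  simp only [fockFactor, Finset.prod_mul_distrib, Finset.mul_sum, Finset.sum_mul]
  refine Finset.sum_congr rfl fun α _ => ?_
  push_cast
  rw [Finset.prod_mul_distrib]
  ring

theorem toeplitz_congr_ae {ι : Type} [Fintype ι] {φ φ' : (ι → ℂ) → ℂ} (h : φ =ᵐ[volume] φ')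
    (p : MvPolynomial ι ℂ) :
    toeplitz φ (fun w => MvPolynomial.eval w p) = toeplitz φ' fun w => MvPolynomial.eval w p := by
  funext z
  rw [toeplitz_eval, toeplitz_eval]
  refine integral_congr_ae ?_
  filter_upwards [h] with w hw
  rw [hw]

section Blocks

variable {k : ℕ} {n : Fin k → ℕ}

theorem measurable_blockNorm : Measurable fun w : BlockIndex n → ℂ => blockNorm w := by
  refine measurable_pi_iff.2 fun j => ?_
  unfold blockNorm
  fun_prop

theorem BddMeasurable.prod {b : Fin k → ℝ → ℂ} {C : Fin k → ℝ}
    (hb : ∀ j, BddMeasurable (b j) (C j)) :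
    BddMeasurable (fun r : Fin k → ℝ => ∏ j, b j (r j)) (∏ j, C j) := by
  refine ⟨Finset.measurable_prod _ fun j _ => (hb j).measurable.comp (measurable_pi_apply j),
    fun r => ?_⟩
  rw [norm_prod]
  exact Finset.prod_le_prod (fun _ _ => norm_nonneg _) fun j _ => (hb j).bound _

theorem BddMeasurable.quasiRadial {a : (Fin k → ℝ) → ℂ} {C : ℝ} (ha : BddMeasurable a C) :
    BddMeasurable (quasiRadial n a) C :=
  ha.comp measurable_blockNorm

theorem IsEigenvalueFunction.congr_ae (hn : ∀ j, 1 ≤ n j) {a a' : (Fin k → ℝ) → ℂ}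
    (h : a =ᵐ[orthantMeasure k] a') {γ : (Fin k → ℕ) → ℂ} (ha : IsEigenvalueFunction n a γ) :
    IsEigenvalueFunction n a' γ := by
  rintro m f ⟨p, hp, rfl⟩
  rw [← ha m _ ⟨p, hp, rfl⟩]
  exact (toeplitz_congr_ae (quasiRadial_ae_eq hn h) p).symm

theorem IsEigenvalueFunction.add {a a' : (Fin k → ℝ) → ℂ} {C C' : ℝ} (ha : BddMeasurable a C)
    (ha' : BddMeasurable a' C') {γ γ' : (Fin k → ℕ) → ℂ} (h : IsEigenvalueFunction n a γ)
    (h' : IsEigenvalueFunction n a' γ') :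
    IsEigenvalueFunction n (fun r => a r + a' r) fun m => γ m + γ' m := by
  rintro m f ⟨p, hp, rfl⟩
  funext z
  have e := congrFun (h m _ ⟨p, hp, rfl⟩) z
  have e' := congrFun (h' m _ ⟨p, hp, rfl⟩) z
  rw [toeplitz_eval] at e e' ⊢
  rw [add_mul, ← e, ← e', ← integral_add
    (ha.quasiRadial.integrable_mul (integrable_polyWeight p z))
    (ha'.quasiRadial.integrable_mul (integrable_polyWeight p z))]
  refine integral_congr_ae (.of_forall fun w => ?_)
  simp only [quasiRadial]
  ring

theorem IsEigenvalueFunction.const_mul {a : (Fin k → ℝ) → ℂ} (c : ℂ) {γ : (Fin k → ℕ) → ℂ}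
    (h : IsEigenvalueFunction n a γ) :
    IsEigenvalueFunction n (fun r => c * a r) fun m => c * γ m := by
  rintro m f ⟨p, hp, rfl⟩
  funext z
  have e := congrFun (h m _ ⟨p, hp, rfl⟩) z
  rw [toeplitz_eval] at e ⊢
  rw [mul_assoc, ← e, ← integral_const_mul]
  refine integral_congr_ae (.of_forall fun w => ?_)
  simp only [quasiRadial]
  ring

/-- Each block `z_{(j)}` has a coordinate, so every multidegree has a nonzero monomial, whose
eigenvalue is determined. -/
theorem IsEigenvalueFunction.unique (hn : ∀ j, 1 ≤ n j) {a : (Fin k → ℝ) → ℂ}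
    {γ γ' : (Fin k → ℕ) → ℂ} (h : IsEigenvalueFunction n a γ)
    (h' : IsEigenvalueFunction n a γ') : γ = γ' := by
  classical
  funext m
  set d : BlockIndex n →₀ ℕ :=
    ∑ j : Fin k, Finsupp.single (⟨j, ⟨0, hn j⟩⟩ : BlockIndex n) (m j) with hd
  have hp : (MvPolynomial.monomial d (1 : ℂ)).IsWeightedHomogeneous
      (fun i : BlockIndex n => (Pi.single i.1 1 : Fin k → ℕ)) m := by
    refine MvPolynomial.isWeightedHomogeneous_monomial _ _ _ ?_
    rw [hd, map_sum]
    simp only [Finsupp.weight_single]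
    funext j
    rw [Finset.sum_apply]
    simp [Pi.single_apply]
  have e := congrFun (h m _ ⟨_, hp, rfl⟩) 1
  have e' := congrFun (h' m _ ⟨_, hp, rfl⟩) 1
  rw [e] at e'
  simpa [MvPolynomial.eval_monomial] using e'

/-- For a product symbol the Toeplitz integral of a monomial factors over the blocks. -/
theorem isEigenvalueFunction_prod (hn : ∀ j, 1 ≤ n j) {b : Fin k → ℝ → ℂ} {C : Fin k → ℝ}
    (hb : ∀ j, BddMeasurable (b j) (C j)) :
    IsEigenvalueFunction n (fun r => ∏ j, b j (r j))
      fun m => ∏ j, gammaMean (m j + (n j - 1)) fun s => b j (Real.sqrt s) := by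
  rintro m f ⟨p, hp, rfl⟩
  funext z
  have hmono : ∀ α ∈ p.support, ∫ w : BlockIndex n → ℂ, quasiRadial n (fun r => ∏ j, b j (r j)) w *
      (p.coeff α * ∏ i, fockFactor (α i) (z i) (w i)) =
      (∏ j, gammaMean (m j + (n j - 1)) fun s => b j (Real.sqrt s)) *
        (p.coeff α * ∏ i, z i ^ α i) := by
    intro α hα
    have hdeg : ∀ j, ∑ i, α ⟨j, i⟩ = m j := by
      intro j
      have h := congrFun (hp (MvPolynomial.mem_support_iff.1 hα)) j
      rw [Finsupp.weight_apply, Finsupp.sum_fintype _ _ (by simp), Finset.sum_apply,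
        Fintype.sum_sigma, Finset.sum_eq_single j] at h
      · simpa using h
      · intro j' _ hj'
        simp [hj'.symm]
      · simp
    have e : ∀ w : BlockIndex n → ℂ, quasiRadial n (fun r => ∏ j, b j (r j)) w *
        (p.coeff α * ∏ i, fockFactor (α i) (z i) (w i)) = p.coeff α *
        ∏ j, (fun y : Fin (n j) → ℂ => b j (Real.sqrt (∑ i, ‖y i‖ ^ 2)) *
          ∏ i, fockFactor (α ⟨j, i⟩) (z ⟨j, i⟩) (y i)) (fun i => w ⟨j, i⟩) := by
      intro w
      rw [Fintype.prod_sigma, Finset.prod_mul_distrib]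
      simp only [quasiRadial, blockNorm]
      ring
    simp only [e]
    rw [integral_const_mul, integral_prod_blocks n (fun j y =>
      b j (Real.sqrt (∑ i, ‖y i‖ ^ 2)) * ∏ i, fockFactor (α ⟨j, i⟩) (z ⟨j, i⟩) (y i))]
    have hj : ∀ j, ∫ y : Fin (n j) → ℂ, b j (Real.sqrt (∑ i, ‖y i‖ ^ 2)) *
        ∏ i, fockFactor (α ⟨j, i⟩) (z ⟨j, i⟩) (y i) = (∏ i, z ⟨j, i⟩ ^ α ⟨j, i⟩) *
        gammaMean (m j + (n j - 1)) fun s => b j (Real.sqrt s) := by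
      intro j
      rw [← hdeg j]
      exact integral_mul_prod_fockFactor (hn j) ((hb j).comp Real.continuous_sqrt.measurable)
        (fun i => α ⟨j, i⟩) (fun i => z ⟨j, i⟩)
    simp only [hj]
    rw [Finset.prod_mul_distrib, Fintype.prod_sigma (fun i : BlockIndex n => z i ^ α i)]
    ring
  have hint : ∀ α ∈ p.support, Integrable fun w : BlockIndex n → ℂ =>
      quasiRadial n (fun r => ∏ j, b j (r j)) w *
        (p.coeff α * ∏ i, fockFactor (α i) (z i) (w i)) := fun α _ =>
    (BddMeasurable.prod hb).quasiRadial.integrable_mul ((integrable_prod_fockFactor α z).const_mul _)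
  rw [toeplitz_eval]
  simp only [polyWeight, Finset.mul_sum]
  rw [integral_finsetSum _ hint, Finset.sum_congr rfl hmono,
    MvPolynomial.eval_eq', Finset.mul_sum]

/-! ### Symbols as bounded measurable functions -/

theorem exists_bddMeasurable_ae_eq {X : Type*} [MeasurableSpace X] {μ : Measure X}
    (a : Lp ℂ ∞ μ) : ∃ (C : ℝ) (b : X → ℂ), BddMeasurable b C ∧ a =ᵐ[μ] b := by
  have hm := (Lp.aestronglyMeasurable a)
  set f := hm.mk a with hf
  have hfm : Measurable f := hm.stronglyMeasurable_mk.measurable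
  have hs : MeasurableSet {x | ‖f x‖ ≤ ‖a‖} := measurableSet_le hfm.norm measurable_const
  refine ⟨‖a‖, {x | ‖f x‖ ≤ ‖a‖}.indicator f, ⟨hfm.indicator hs, fun x => ?_⟩, ?_⟩
  · by_cases hx : x ∈ {x | ‖f x‖ ≤ ‖a‖}
    · rw [Set.indicator_of_mem hx]; exact hx
    · rw [Set.indicator_of_notMem hx, norm_zero]; exact norm_nonneg _
  · have hbd : ∀ᵐ x ∂μ, ‖a x‖ ≤ ‖a‖ := by
      have h1 := ae_le_eLpNormEssSup (f := a) (μ := μ)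
      filter_upwards [h1] with x hx
      rw [Lp.norm_def, eLpNorm_exponent_top, ← toReal_enorm]
      refine ENNReal.toReal_mono ?_ hx
      rw [← eLpNorm_exponent_top]
      exact Lp.eLpNorm_ne_top a
    filter_upwards [hm.ae_eq_mk, hbd] with x hx hx'
    have : x ∈ {x | ‖f x‖ ≤ ‖a‖} := by
      rw [hx] at hx'
      exact hx'
    rw [Set.indicator_of_mem this]
    exact hx

theorem ae_eq_prod_of_ae_eq {a a' : Fin k → ℝ → ℂ}
    (h : ∀ j, a j =ᵐ[halfLineMeasure] a' j) :
    (fun r : Fin k → ℝ => ∏ j, a j (r j)) =ᵐ[orthantMeasure k] fun r => ∏ j, a' j (r j) := by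
  rw [orthantMeasure_eq_pi]
  have : ∀ j, ∀ᵐ r ∂(Measure.pi fun _ : Fin k => halfLineMeasure), a j (r j) = a' j (r j) :=
    fun j => (Measure.quasiMeasurePreserving_eval (fun _ : Fin k => halfLineMeasure) j).ae (h j)
  filter_upwards [ae_all_iff.2 this] with r hr
  exact Finset.prod_congr rfl fun j _ => hr j

end Blocks

/-! ### Gamma means are Lipschitz for the square-root metric -/

theorem inv_sqrt_le_two_mul_sub (m : ℕ) :
    1 / Real.sqrt (m + 1) ≤ 2 * (Real.sqrt (m + 1) - Real.sqrt m) := by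
  have h1 : (0 : ℝ) < Real.sqrt (m + 1) := Real.sqrt_pos.2 (by positivity)
  have h2 := Real.sq_sqrt (show (0 : ℝ) ≤ m + 1 by positivity)
  have h3 := Real.sq_sqrt (show (0 : ℝ) ≤ m by positivity)
  rw [div_le_iff₀ h1]
  nlinarith [sq_nonneg (Real.sqrt (m + 1) - Real.sqrt m)]

theorem norm_gammaMean_sub_le {b : ℝ → ℂ} {C : ℝ} (hb : BddMeasurable b C) (d m m' : ℕ) :
    ‖gammaMean (m + d) b - gammaMean (m' + d) b‖ ≤ 2 * C * |Real.sqrt m - Real.sqrt m'| := by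
  have hC : 0 ≤ C := (norm_nonneg _).trans (hb.bound 0)
  have mono : ∀ m m' : ℕ, m ≤ m' → ‖gammaMean (m' + d) b - gammaMean (m + d) b‖ ≤
      2 * C * (Real.sqrt m' - Real.sqrt m) := by
    intro m m' h
    induction m', h using Nat.le_induction with
    | base => simp
    | succ l _ ih =>
      have h1 := norm_gammaMean_succ_sub_le hb (l + d)
      have h2 : C / Real.sqrt ((l + d : ℕ) + 1) ≤ C * (1 / Real.sqrt (l + 1)) := by
        rw [mul_one_div]
        have : (0 : ℝ) < Real.sqrt (l + 1) := Real.sqrt_pos.2 (by positivity)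
        gcongr
        exact_mod_cast Nat.le_add_right l d
      have h3 := mul_le_mul_of_nonneg_left (inv_sqrt_le_two_mul_sub l) hC
      have h4 := norm_add_le (gammaMean (l + d + 1) b - gammaMean (l + d) b)
        (gammaMean (l + d) b - gammaMean (m + d) b)
      rw [sub_add_sub_cancel] at h4
      rw [show l + 1 + d = l + d + 1 by ring]
      push_cast at h1 h2 ih ⊢
      linarith
  rcases le_total m m' with h | h
  · rw [norm_sub_rev, abs_sub_comm, abs_of_nonneg (sub_nonneg.2 (Real.sqrt_le_sqrt (by simpa)))]
    exact mono m m' h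
  · rw [abs_of_nonneg (sub_nonneg.2 (Real.sqrt_le_sqrt (by simpa)))]
    exact mono m' m h

/-- The function `m ↦ gammaMean (m + d) b` as an element of `C_{b,u}(ℕ₀, ρ₁)`. -/
theorem exists_Cbu_gammaMean {b : ℝ → ℂ} {C : ℝ} (hb : BddMeasurable b C) (d : ℕ) :
    ∃ F : Cbu 1, ∀ m, (F : LInfty 1) m = gammaMean (m 0 + d) b := by
  have hC : 0 ≤ C := (norm_nonneg _).trans (hb.bound 0)
  refine ⟨⟨BoundedContinuousFunction.ofNormedAddCommGroup (fun m => gammaMean (m 0 + d) b)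
    continuous_of_discreteTopology C fun m => norm_gammaMean_le hb _, ?_⟩, fun m => rfl⟩
  intro ε hε
  refine ⟨ε / (2 * C + 1), by positivity, fun m m' h => ?_⟩
  rw [sqrtDist, Fin.sum_univ_one, lt_div_iff₀ (by positivity)] at h
  have := norm_gammaMean_sub_le hb d (m 0) (m' 0)
  refine lt_of_le_of_lt this ?_
  have h0 := abs_nonneg (Real.sqrt (m 0) - Real.sqrt (m' 0))
  nlinarith

/-! ### Finitely supported sequences -/

theorem gammaMean_congr {N : ℕ} {b b' : ℝ → ℂ} (h : ∀ s, 0 < s → b s = b' s) :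
    gammaMean N b = gammaMean N b' := by
  refine integral_congr_ae (.of_forall fun s => ?_)
  rcases lt_or_ge 0 s with hs | hs
  · simp only [h s hs]
  · simp only [gammaDensity_of_nonpos hs, Complex.ofReal_zero, mul_zero]

theorem BddMeasurable.add {X : Type*} [MeasurableSpace X] {b b' : X → ℂ} {C C' : ℝ}
    (hb : BddMeasurable b C) (hb' : BddMeasurable b' C') :
    BddMeasurable (fun x => b x + b' x) (C + C') :=
  ⟨hb.measurable.add hb'.measurable,
    fun x => (norm_add_le _ _).trans (add_le_add (hb.bound x) (hb'.bound x))⟩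

theorem BddMeasurable.const_mul {X : Type*} [MeasurableSpace X] {b : X → ℂ} {C : ℝ} (c : ℂ)
    (hb : BddMeasurable b C) : BddMeasurable (fun x => c * b x) (‖c‖ * C) :=
  ⟨hb.measurable.const_mul c, fun x => by
    rw [norm_mul]; exact mul_le_mul_of_nonneg_left (hb.bound x) (norm_nonneg c)⟩

theorem gammaMean_add {b b' : ℝ → ℂ} {C C' : ℝ} (hb : BddMeasurable b C)
    (hb' : BddMeasurable b' C') (N : ℕ) :
    gammaMean N (fun s => b s + b' s) = gammaMean N b + gammaMean N b' := by
  simp only [gammaMean, add_mul]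
  exact integral_add (integrable_mul_gammaDensity hb N) (integrable_mul_gammaDensity hb' N)

theorem gammaMean_const_mul (c : ℂ) (b : ℝ → ℂ) (N : ℕ) :
    gammaMean N (fun s => c * b s) = c * gammaMean N b := by
  simp only [gammaMean, mul_assoc]
  exact integral_const_mul _ _

/-- `τ` is a uniform limit of sequences `m ↦ gammaMean (m + d) b` with `b` bounded. -/
def Approximable (d : ℕ) (τ : ℕ → ℂ) : Prop :=
  ∀ ε : ℝ, 0 < ε → ∃ (C : ℝ) (b : ℝ → ℂ), BddMeasurable b C ∧
    ∀ m, ‖gammaMean (m + d) b - τ m‖ ≤ ε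

theorem approximable_gammaMean (d : ℕ) {b : ℝ → ℂ} {C : ℝ} (hb : BddMeasurable b C) :
    Approximable d fun m => gammaMean (m + d) b :=
  fun ε hε => ⟨C, b, hb, fun m => by simpa using hε.le⟩

theorem Approximable.add {d : ℕ} {τ τ' : ℕ → ℂ} (h : Approximable d τ) (h' : Approximable d τ') :
    Approximable d fun m => τ m + τ' m := by
  intro ε hε
  obtain ⟨C, b, hb, H⟩ := h (ε / 2) (half_pos hε)
  obtain ⟨C', b', hb', H'⟩ := h' (ε / 2) (half_pos hε)
  refine ⟨_, _, hb.add hb', fun m => ?_⟩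
  rw [gammaMean_add hb hb', add_sub_add_comm]
  linarith [norm_add_le (gammaMean (m + d) b - τ m) (gammaMean (m + d) b' - τ' m), H m, H' m]

theorem Approximable.const_mul {d : ℕ} {τ : ℕ → ℂ} (c : ℂ) (h : Approximable d τ) :
    Approximable d fun m => c * τ m := by
  intro ε hε
  obtain ⟨C, b, hb, H⟩ := h (ε / (‖c‖ + 1)) (by positivity)
  refine ⟨_, _, hb.const_mul c, fun m => ?_⟩
  rw [gammaMean_const_mul, ← mul_sub, norm_mul]
  have h1 := mul_le_mul_of_nonneg_left (H m) (norm_nonneg c)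
  refine h1.trans ?_
  rw [mul_div_assoc', div_le_iff₀ (by positivity)]
  nlinarith

theorem approximable_zero (d : ℕ) : Approximable d fun _ => 0 := by
  have hb : BddMeasurable (fun _ : ℝ => (0 : ℂ)) 0 := ⟨measurable_const, by simp⟩
  simpa [gammaMean] using approximable_gammaMean d hb

theorem Approximable.sum {d : ℕ} {ι : Type*} (S : Finset ι) {τ : ι → ℕ → ℂ}
    (h : ∀ i ∈ S, Approximable d (τ i)) : Approximable d fun m => ∑ i ∈ S, τ i m := by
  classical
  induction S using Finset.induction_on with
  | empty => simpa using approximable_zero d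
  | insert i S hi ih =>
    simp only [Finset.sum_insert hi]
    exact (h i (Finset.mem_insert_self _ _)).add
      (ih fun j hj => h j (Finset.mem_insert_of_mem hj))

theorem Approximable.of_forall_close {d : ℕ} {τ : ℕ → ℂ}
    (h : ∀ ε : ℝ, 0 < ε → ∃ τ', Approximable d τ' ∧ ∀ m, ‖τ' m - τ m‖ ≤ ε) :
    Approximable d τ := by
  intro ε hε
  obtain ⟨τ', h', H⟩ := h (ε / 2) (half_pos hε)
  obtain ⟨C, b, hb, H'⟩ := h' (ε / 2) (half_pos hε)
  refine ⟨C, b, hb, fun m => ?_⟩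
  have := norm_add_le (gammaMean (m + d) b - τ' m) (τ' m - τ m)
  rw [sub_add_sub_cancel] at this
  linarith [H m, H' m]

/-- Geometric sequences are Gamma means of exponentials. -/
theorem approximable_pow (d : ℕ) {q : ℝ} (hq : 0 < q) (hq1 : q ≤ 1) :
    Approximable d fun m => (q : ℂ) ^ m := by
  set c : ℝ := 1 / q - 1 with hc
  have hc0 : 0 ≤ c := by rw [hc, sub_nonneg, le_div_iff₀ hq]; linarith
  have hcq : 1 + c = 1 / q := by rw [hc]; ring
  -- truncation to the positive half-line, the only part that matters, makes the symbol bounded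
  have hb : BddMeasurable (fun s : ℝ => (Real.exp (-(c * max s 0)) : ℂ)) 1 := by
    refine ⟨by fun_prop, fun s => ?_⟩
    rw [Complex.norm_real, Real.norm_of_nonneg (Real.exp_pos _).le, Real.exp_le_one_iff]
    have := mul_nonneg hc0 (le_max_right s 0)
    linarith
  have hval : ∀ N : ℕ, gammaMean N (fun s : ℝ => (Real.exp (-(c * max s 0)) : ℂ))
      = (q : ℂ) ^ (N + 1) := by
    intro N
    have h := integral_pow_mul_exp_neg N (show 0 < 1 + c by linarith)
    rw [gammaMean_eq_setIntegral]
    have e : ∀ s ∈ Set.Ioi (0 : ℝ), (Real.exp (-(c * max s 0)) : ℂ) *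
        ((s ^ N * Real.exp (-s) / N.factorial : ℝ) : ℂ) =
        ((s ^ N * Real.exp (-((1 + c) * s)) / N.factorial : ℝ) : ℂ) := by
      intro s hs
      rw [max_eq_left (le_of_lt hs), ← Complex.ofReal_mul,
        show -((1 + c) * s) = -(c * s) + -s by ring, Real.exp_add]
      congr 1
      ring
    rw [setIntegral_congr_fun measurableSet_Ioi e, integral_complex_ofReal, integral_div, h, hcq,
      one_div, inv_pow]
    have : (N.factorial : ℝ) ≠ 0 := by positivity
    rw [← Complex.ofReal_pow]
    congr 1
    field_simp
  have h := (approximable_gammaMean d hb).const_mul ((q : ℂ) ^ (d + 1))⁻¹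
  simp only [hval] at h
  have hqc : (q : ℂ) ≠ 0 := by exact_mod_cast hq.ne'
  convert! h using 2 with m
  rw [show m + d + 1 = (d + 1) + m by ring, pow_add _ (d + 1),
    inv_mul_cancel_left₀ (pow_ne_zero _ hqc)]

/-- The indicator of `i` is the limit of `q^{-i} (q^m - ∑_{l < i} q^l 1_{m = l})` as `q → 0`. -/
theorem approximable_single (d i : ℕ) : Approximable d fun m => if m = i then 1 else 0 := by
  induction i using Nat.strong_induction_on with
  | _ i ih =>
    refine Approximable.of_forall_close fun ε hε => ?_
    set q : ℝ := min ε 1 with hq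
    have hq0 : 0 < q := lt_min hε one_pos
    have hq1 : q ≤ 1 := min_le_right _ _
    have hqc : (q : ℂ) ≠ 0 := by exact_mod_cast hq0.ne'
    refine ⟨fun m => ((q : ℂ) ^ i)⁻¹ * ((q : ℂ) ^ m + (-1) *
      ∑ l ∈ Finset.range i, (q : ℂ) ^ l * if m = l then 1 else 0), ?_, fun m => ?_⟩
    · refine ((approximable_pow d hq0 hq1).add (Approximable.const_mul _
        (Approximable.sum _ fun l hl => ?_))).const_mul _
      exact (ih l (Finset.mem_range.1 hl)).const_mul _
    · simp only [mul_ite, mul_one, mul_zero, Finset.sum_ite_eq, Finset.mem_range]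
      rcases lt_trichotomy m i with h | h | h
      · simp [h, h.ne, hε.le]
      · subst h
        simp [hqc, hε.le]
      · obtain ⟨l, rfl⟩ : ∃ l, m = i + (l + 1) := ⟨m - i - 1, by omega⟩
        simp only [show ¬ (i + (l + 1) < i) by omega, if_false, add_zero, pow_add _ i,
          show ¬ (i + (l + 1) = i) by omega, sub_zero]
        rw [inv_mul_cancel_left₀ (pow_ne_zero _ hqc), norm_pow, Complex.norm_real,
          Real.norm_of_nonneg hq0.le, pow_succ]
        calc q ^ l * q ≤ 1 * q := by
              gcongr
              exact pow_le_one₀ hq0.le hq1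
          _ ≤ ε := by rw [one_mul]; exact min_le_left _ _

/-- A sequence that can be approximated up to finitely many terms can be approximated. -/
theorem Approximable.of_eventually {d : ℕ} {τ : ℕ → ℂ}
    (h : ∀ ε : ℝ, 0 < ε → ∃ τ', Approximable d τ' ∧ ∃ M, ∀ m ≥ M, ‖τ' m - τ m‖ ≤ ε) :
    Approximable d τ := by
  refine Approximable.of_forall_close fun ε hε => ?_
  obtain ⟨τ', h', M, H⟩ := h ε hε
  refine ⟨fun m => τ' m + ∑ i ∈ Finset.range M, (τ i - τ' i) * if m = i then 1 else 0,
    h'.add (Approximable.sum _ fun i _ => (approximable_single d i).const_mul _), fun m => ?_⟩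
  simp only [mul_ite, mul_one, mul_zero, Finset.sum_ite_eq, Finset.mem_range]
  by_cases hm : m < M
  · simp [hm, hε.le]
  · simpa [hm] using H m (not_lt.1 hm)

/-! ### Gaussian limit of the Gamma distributions -/

/-- The density of the normal distribution of variance `1/4`. -/
def normalQuarter (u : ℝ) : ℝ := Real.sqrt (2 / Real.pi) * Real.exp (-2 * u ^ 2)

/-- The density of `√S - √N`, where `S` has the Gamma distribution of shape `N + 1`. -/
def rootDensity (N : ℕ) (u : ℝ) : ℝ :=
  2 * (Real.sqrt N + u) * gammaDensity N ((Real.sqrt N + u) ^ 2) *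
    (Set.Ioi (-Real.sqrt N)).indicator 1 u

theorem normalQuarter_nonneg (u : ℝ) : 0 ≤ normalQuarter u := by
  unfold normalQuarter; positivity

theorem integrable_normalQuarter : Integrable normalQuarter :=
  (integrable_exp_neg_mul_sq two_pos).const_mul _

theorem integral_normalQuarter : ∫ u, normalQuarter u = 1 := by
  have hpi := Real.pi_pos
  simp only [normalQuarter]
  rw [integral_const_mul, integral_gaussian, ← Real.sqrt_mul (by positivity),
    div_mul_div_cancel₀ hpi.ne', div_self two_ne_zero, Real.sqrt_one]

theorem rootDensity_nonneg (N : ℕ) (u : ℝ) : 0 ≤ rootDensity N u := by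
  by_cases hu : u ∈ Set.Ioi (-Real.sqrt N)
  · have : 0 < Real.sqrt N + u := by have := Set.mem_Ioi.1 hu; linarith
    have := gammaDensity_nonneg N ((Real.sqrt N + u) ^ 2)
    rw [rootDensity, Set.indicator_of_mem hu, Pi.one_apply]
    positivity
  · rw [rootDensity, Set.indicator_of_notMem hu, mul_zero]

theorem gammaMean_comp_sqrt (N : ℕ) (b : ℝ → ℂ) :
    gammaMean N (fun s => b (Real.sqrt s)) =
      ∫ u, b (Real.sqrt N + u) * (rootDensity N u : ℂ) := by
  have h := integral_comp_sq_Ioi fun s => b (Real.sqrt s) * (gammaDensity N s : ℂ)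
  have e1 : gammaMean N (fun s => b (Real.sqrt s)) =
      ∫ s in Set.Ioi (0 : ℝ), b (Real.sqrt s) * (gammaDensity N s : ℂ) := by
    rw [gammaMean, ← integral_indicator measurableSet_Ioi]
    refine integral_congr_ae (.of_forall fun s => ?_)
    by_cases hs : s ∈ Set.Ioi (0 : ℝ)
    · simp only [Set.indicator_of_mem hs]
    · simp only [Set.indicator_of_notMem hs, gammaDensity_of_nonpos (not_lt.1 hs),
        Complex.ofReal_zero, mul_zero]
  rw [e1, ← h, ← integral_indicator measurableSet_Ioi, ← integral_add_left_eq_self _ (Real.sqrt N)]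
  refine integral_congr_ae (.of_forall fun u => ?_)
  by_cases hu : u ∈ Set.Ioi (-Real.sqrt N)
  · have h0 : 0 < Real.sqrt N + u := by have := Set.mem_Ioi.1 hu; linarith
    simp only [rootDensity, Set.indicator_of_mem hu,
      Set.indicator_of_mem (show Real.sqrt N + u ∈ Set.Ioi 0 from h0), Real.sqrt_sq h0.le,
      Pi.one_apply]
    push_cast
    ring
  · have h0 : Real.sqrt N + u ∉ Set.Ioi 0 := by
      have := Set.mem_Ioi.not.1 hu
      rw [Set.mem_Ioi]; linarith
    simp only [rootDensity, Set.indicator_of_notMem hu, Set.indicator_of_notMem h0, mul_zero,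
      Complex.ofReal_zero]

theorem integral_rootDensity (N : ℕ) : ∫ u, rootDensity N u = 1 := by
  have h := gammaMean_comp_sqrt N fun _ => 1
  simp only [gammaMean, one_mul] at h
  rw [integral_complex_ofReal, integral_complex_ofReal, integral_gammaDensity] at h
  exact_mod_cast h.symm

theorem integrable_rootDensity (N : ℕ) : Integrable (rootDensity N) := by
  by_contra h
  have h1 := integral_rootDensity N
  rw [integral_undef h] at h1
  exact zero_ne_one h1

theorem tendsto_log_sub_div_sq :
    Filter.Tendsto (fun t : ℝ => (Real.log (1 + t) - t) / t ^ 2) (nhdsWithin 0 {0}ᶜ)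
      (nhds (-1 / 2)) := by
  have hev : ∀ᶠ t : ℝ in nhdsWithin 0 {0}ᶜ,
      |(Real.log (1 + t) - t) / t ^ 2 - -1 / 2| ≤ 2 * |t| := by
    have h1 : ∀ᶠ t : ℝ in nhdsWithin 0 {0}ᶜ, |t| < 1 / 2 := by
      refine nhdsWithin_le_nhds ?_
      have : Filter.Tendsto (fun t : ℝ => |t|) (nhds 0) (nhds |(0 : ℝ)|) :=
        continuous_abs.tendsto 0
      rw [abs_zero] at this
      exact this.eventually (gt_mem_nhds (by norm_num))
    filter_upwards [h1, self_mem_nhdsWithin] with t ht ht0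
    have ht0 : t ≠ 0 := ht0
    have h := Real.abs_log_sub_add_sum_range_le (x := -t) (by rw [abs_neg]; linarith) 2
    rw [Finset.sum_range_succ, Finset.sum_range_one, abs_neg, sub_neg_eq_add] at h
    norm_num at h
    have e : (Real.log (1 + t) - t) / t ^ 2 - -1 / 2
        = (-t + t ^ 2 / 2 + Real.log (1 + t)) / t ^ 2 - (t ^ 2 / 2 - t ^ 2 / 2) / t ^ 2 := by
      field_simp
      ring
    rw [sub_self, zero_div, sub_zero] at e
    rw [e, abs_div, abs_of_pos (show 0 < t ^ 2 by positivity), div_le_iff₀ (by positivity)]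
    refine h.trans ?_
    rw [div_le_iff₀ (by linarith), ← sq_abs t]
    have := abs_nonneg t
    nlinarith [pow_nonneg this 3]
  rw [tendsto_iff_norm_sub_tendsto_zero]
  refine squeeze_zero' (.of_forall fun _ => norm_nonneg _) hev ?_
  refine Filter.Tendsto.mono_left ?_ nhdsWithin_le_nhds
  have : Filter.Tendsto (fun t : ℝ => 2 * |t|) (nhds 0) (nhds (2 * |(0 : ℝ)|)) :=
    (continuous_const.mul continuous_abs).tendsto 0
  simpa using this

/-- With `t = u / √N`, the density is the Stirling ratio times
`exp(2 u² (log (1 + t) - t) / t² - u² + log (1 + t))`. -/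
theorem tendsto_rootDensity (u : ℝ) (hu : u ≠ 0) :
    Filter.Tendsto (fun N => rootDensity N u) Filter.atTop (nhds (normalQuarter u)) := by
  have hpi := Real.pi_pos
  have hsq : Filter.Tendsto (fun N : ℕ => Real.sqrt N) Filter.atTop Filter.atTop :=
    Real.tendsto_sqrt_atTop.comp tendsto_natCast_atTop_atTop
  have ht : Filter.Tendsto (fun N : ℕ => u / Real.sqrt N) Filter.atTop (nhds 0) :=
    hsq.const_div_atTop u
  have ht' : Filter.Tendsto (fun N : ℕ => u / Real.sqrt N) Filter.atTop (nhdsWithin 0 {0}ᶜ) := by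
    refine tendsto_nhdsWithin_iff.2 ⟨ht, ?_⟩
    filter_upwards [hsq.eventually_gt_atTop 0] with N hN
    exact div_ne_zero hu hN.ne'
  have hlog : Filter.Tendsto (fun N : ℕ => Real.log (1 + u / Real.sqrt N)) Filter.atTop
      (nhds 0) := by
    have : Filter.Tendsto (fun t : ℝ => Real.log (1 + t)) (nhds 0) (nhds (Real.log (1 + 0))) :=
      ((continuous_const.add continuous_id).continuousAt.log (by simp))
    rw [add_zero, Real.log_one] at this
    exact this.comp ht
  have hexp := (((tendsto_log_sub_div_sq.comp ht').const_mul (2 * u ^ 2)).sub_const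
    (u ^ 2)).add hlog
  have hst : Filter.Tendsto (fun N => Real.sqrt 2 / Stirling.stirlingSeq N) Filter.atTop
      (nhds (Real.sqrt 2 / Real.sqrt Real.pi)) :=
    tendsto_const_nhds.div Stirling.tendsto_stirlingSeq_sqrt_pi (Real.sqrt_pos.2 hpi).ne'
  have hlim := hst.mul ((Real.continuous_exp.tendsto _).comp hexp)
  have e : Real.sqrt 2 / Real.sqrt Real.pi * Real.exp (2 * u ^ 2 * (-1 / 2) - u ^ 2 + 0)
      = normalQuarter u := by
    rw [normalQuarter, Real.sqrt_div zero_le_two]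
    ring_nf
  rw [e] at hlim
  refine hlim.congr' ?_
  filter_upwards [hsq.eventually_gt_atTop 0, hsq.eventually_gt_atTop (-u),
    Filter.eventually_gt_atTop 0] with N hN hNu hN0
  set x := Real.sqrt N with hx
  have hxx : x ^ 2 = N := Real.sq_sqrt (Nat.cast_nonneg N)
  have hpos : 0 < x + u := by linarith
  have hmem : u ∈ Set.Ioi (-x) := by rw [Set.mem_Ioi]; linarith
  have h1t : 0 < 1 + u / x := by
    have : 1 + u / x = (x + u) / x := by field_simp
    rw [this]; positivity
  have hfac : (N.factorial : ℝ) = Stirling.stirlingSeq N * (Real.sqrt 2 * x) *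
      (x ^ 2 / Real.exp 1) ^ N := by
    have : (0 : ℝ) < N := by exact_mod_cast hN0
    rw [Stirling.stirlingSeq, Real.sqrt_mul zero_le_two, ← hx, hxx]
    field_simp
  have hSne : Stirling.stirlingSeq N ≠ 0 := by
    obtain ⟨M, rfl⟩ : ∃ M, N = M + 1 := ⟨N - 1, by omega⟩
    exact (Stirling.stirlingSeq'_pos M).ne'
  have hE : Real.exp (2 * u ^ 2 * ((Real.log (1 + u / x) - u / x) / (u / x) ^ 2) - u ^ 2 +
      Real.log (1 + u / x)) = (1 + u / x) ^ (2 * N + 1) * Real.exp (-(2 * u * x) - u ^ 2) := by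
    rw [← Real.exp_log (pow_pos h1t (2 * N + 1)), ← Real.exp_add, Real.log_pow]
    congr 1
    push_cast
    rw [← hxx]
    field_simp
    ring
  simp only [Function.comp]
  rw [rootDensity, ← hx, Set.indicator_of_mem hmem, Pi.one_apply, mul_one,
    gammaDensity_of_pos (by positivity), hE, hfac,
    show 1 + u / x = (x + u) / x by field_simp,
    show -(x + u) ^ 2 = (-(2 * u * x) - u ^ 2) + -(x ^ 2) by ring, Real.exp_add _ (-(x ^ 2)), hxx,
    Real.exp_neg, ← pow_mul (x + u) 2 N, div_pow, div_pow, ← Real.exp_nat_mul, mul_one, ← hxx]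
  have h2 : Real.sqrt 2 ^ 2 = 2 := Real.sq_sqrt zero_le_two
  field_simp
  rw [h2]
  ring

/-- Pointwise convergence of probability densities implies convergence in `L¹`. -/
theorem tendsto_integral_abs_rootDensity_sub :
    Filter.Tendsto (fun N => ∫ u, |rootDensity N u - normalQuarter u|) Filter.atTop (nhds 0) := by
  have hi := integrable_normalQuarter
  have h : Filter.Tendsto (fun N => ∫ u, max (normalQuarter u - rootDensity N u) 0) Filter.atTop
      (nhds (∫ _ : ℝ, (0 : ℝ))) := by
    refine tendsto_integral_of_dominated_convergence normalQuarter
      (fun N => ((hi.sub (integrable_rootDensity N)).pos_part).aestronglyMeasurable) hi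
      (fun N => .of_forall fun u => ?_) ?_
    · rw [Real.norm_of_nonneg (le_max_right _ _)]
      exact max_le (by linarith [rootDensity_nonneg N u]) (normalQuarter_nonneg u)
    · filter_upwards [compl_mem_ae_iff.2 (measure_singleton (0 : ℝ))] with u hu
      have := ((tendsto_const_nhds (x := normalQuarter u)).sub (tendsto_rootDensity u hu)).max
        (tendsto_const_nhds (x := (0 : ℝ)))
      simpa using this
  rw [integral_zero] at h
  have h2 := h.const_mul 2
  rw [mul_zero] at h2
  refine h2.congr fun N => ?_
  have hr := integrable_rootDensity N
  have hp : Integrable fun u => max (normalQuarter u - rootDensity N u) 0 := (hi.sub hr).pos_part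
  have e : ∀ u, |rootDensity N u - normalQuarter u| =
      (rootDensity N u - normalQuarter u) + 2 * max (normalQuarter u - rootDensity N u) 0 := by
    intro u
    rcases le_total (rootDensity N u) (normalQuarter u) with h | h
    · rw [abs_of_nonpos (by linarith), max_eq_left (by linarith)]; ring
    · rw [abs_of_nonneg (by linarith), max_eq_right (by linarith)]; ring
  simp only [e]
  have hd : Integrable fun u => rootDensity N u - normalQuarter u := hr.sub hi
  rw [integral_add hd (hp.const_mul 2), integral_sub hr hi, integral_rootDensity,
    integral_normalQuarter, integral_const_mul]
  ring

/-! ### Deconvolution of the Gaussian -/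

theorem exists_inverse_fourier {χ : ℝ → ℂ} (hc : HasCompactSupport χ)
    (hs : ContDiff ℝ (⊤ : ℕ∞) χ) :
    ∃ η : ℝ → ℂ, Continuous η ∧ Integrable η ∧ ∫ x, η x = χ 0 ∧
      ∀ x, η x = ∫ ξ : ℝ, Complex.exp (2 * Real.pi * ξ * x * Complex.I) * χ ξ := by
  set F : SchwartzMap ℝ ℂ := hc.toSchwartzMap hs with hF
  have hFc : ∀ x, F x = χ x := fun _ => rfl
  set G : SchwartzMap ℝ ℂ := FourierTransformInv.fourierInv F with hG
  refine ⟨G, G.continuous, G.integrable, ?_, fun x => ?_⟩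
  · have h : FourierTransform.fourier G = F := by rw [hG]; simp
    have h0 : (FourierTransform.fourier G) 0 = χ 0 := by rw [h, hFc]
    rw [SchwartzMap.fourier_coe, Real.fourier_eq'] at h0
    rw [← h0]
    simp
  · rw [hG, SchwartzMap.fourierInv_coe, Real.fourierInv_eq']
    refine integral_congr_ae (.of_forall fun ξ => ?_)
    have hin : inner ℝ ξ x = ξ * x := by simp [mul_comm]
    simp only [hFc, smul_eq_mul, hin]
    push_cast
    ring_nf

theorem integral_exp_mul_normalQuarter (ξ : ℝ) :
    ∫ u : ℝ, Complex.exp (-(2 * Real.pi * ξ * u * Complex.I)) * (normalQuarter u : ℂ) =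
      (Real.exp (-(Real.pi ^ 2 * ξ ^ 2 / 2)) : ℂ) := by
  have hpi := Real.pi_pos
  have h := fourierIntegral_gaussian (b := 2) (by norm_num) (-(2 * Real.pi * ξ) : ℂ)
  have e : ∀ u : ℝ, Complex.exp (-(2 * Real.pi * ξ * u * Complex.I)) * (normalQuarter u : ℂ) =
      (Real.sqrt (2 / Real.pi) : ℂ) * (Complex.exp (Complex.I * (-(2 * Real.pi * ξ)) * u) *
        Complex.exp (-2 * u ^ 2)) := by
    intro u
    rw [normalQuarter]
    push_cast
    rw [show -(2 * (Real.pi : ℂ) * ξ * u * Complex.I) = Complex.I * (-(2 * Real.pi * ξ)) * u by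
      ring]
    ring
  simp only [e]
  rw [integral_const_mul, h]
  have h1 : ((Real.pi : ℂ) / 2) ^ (1 / 2 : ℂ) = (Real.sqrt (Real.pi / 2) : ℂ) := by
    rw [Real.sqrt_eq_rpow, Complex.ofReal_cpow (by positivity)]
    push_cast
    rfl
  rw [h1, ← mul_assoc, ← Complex.ofReal_mul, ← Real.sqrt_mul (by positivity),
    div_mul_div_cancel₀ hpi.ne', div_self two_ne_zero, Real.sqrt_one, Complex.ofReal_one, one_mul]
  push_cast
  congr 1
  ring

/-- There are approximate identities of the form `normalQuarter ⋆ k` with integrable `k`: let `η`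
have a smooth compactly supported Fourier transform and divide the latter by the Fourier transform
of the Gaussian, which has no zeros. -/
theorem exists_deconvolution_kernel :
    ∃ η : ℝ → ℂ, Integrable η ∧ ∫ x, η x = 1 ∧ ∀ R : ℝ, 0 < R → ∃ k : ℝ → ℂ,
      Continuous k ∧ Integrable k ∧ ∀ v, ∫ u, (normalQuarter u : ℂ) * k (v - u) =
        R * η (R * v) := by
  let χ : ContDiffBump (0 : ℝ) := default
  have hχs : ContDiff ℝ (⊤ : ℕ∞) fun x => (χ x : ℂ) := Complex.ofRealCLM.contDiff.comp χ.contDiff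
  have hχc : HasCompactSupport fun x => (χ x : ℂ) :=
    χ.hasCompactSupport.comp_left Complex.ofReal_zero
  obtain ⟨η, -, hηi, hη1, hη⟩ := exists_inverse_fourier hχc hχs
  refine ⟨η, hηi, ?_, fun R hR => ?_⟩
  · rw [hη1, χ.one_of_mem_closedBall (Metric.mem_closedBall_self χ.rIn_pos.le), Complex.ofReal_one]
  set w : ℝ → ℂ := fun ξ => (χ (ξ / R) : ℂ) * (Real.exp (Real.pi ^ 2 * ξ ^ 2 / 2) : ℂ) with hw
  have hws : ContDiff ℝ (⊤ : ℕ∞) w := by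
    refine (hχs.comp (contDiff_id.div_const R)).mul (Complex.ofRealCLM.contDiff.comp ?_)
    exact Real.contDiff_exp.comp ((contDiff_const.mul (contDiff_id.pow 2)).div_const 2)
  have hwc : HasCompactSupport w := by
    have h : HasCompactSupport fun ξ : ℝ => (χ (ξ / R) : ℂ) := by
      have := hχc.comp_homeomorph (Homeomorph.mulRight₀ R⁻¹ (inv_ne_zero hR.ne'))
      simpa [Function.comp_def, div_eq_mul_inv] using this
    exact h.mul_right
  obtain ⟨k, hkc, hki, -, hk⟩ := exists_inverse_fourier hwc hws
  refine ⟨k, hkc, hki, fun v => ?_⟩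
  have hwi : Integrable w := hws.continuous.integrable_of_hasCompactSupport hwc
  have hint : Integrable (fun p : ℝ × ℝ =>
      Complex.exp (2 * Real.pi * p.2 * (v - p.1) * Complex.I) * ((normalQuarter p.1 : ℂ) * w p.2))
      (volume.prod volume) := by
    refine (integrable_normalQuarter.ofReal.mul_prod hwi).bdd_mul (c := 1)
      (by fun_prop : Continuous _).aestronglyMeasurable (.of_forall fun p => ?_)
    rw [show 2 * (Real.pi : ℂ) * p.2 * (v - p.1) * Complex.I
      = ((2 * Real.pi * p.2 * (v - p.1) : ℝ) : ℂ) * Complex.I by push_cast; ring,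
      Complex.norm_exp_ofReal_mul_I]
  calc ∫ u, (normalQuarter u : ℂ) * k (v - u)
      = ∫ u : ℝ, ∫ ξ : ℝ, Complex.exp (2 * Real.pi * ξ * (v - u) * Complex.I) *
          ((normalQuarter u : ℂ) * w ξ) := by
        refine integral_congr_ae (.of_forall fun u => ?_)
        simp only [hk, ← integral_const_mul]
        refine integral_congr_ae (.of_forall fun ξ => ?_)
        push_cast
        ring
    _ = ∫ ξ : ℝ, ∫ u : ℝ, Complex.exp (2 * Real.pi * ξ * (v - u) * Complex.I) *
          ((normalQuarter u : ℂ) * w ξ) := integral_integral_swap hint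
    _ = ∫ ξ : ℝ, (fun ζ : ℝ => Complex.exp (2 * Real.pi * ζ * ((R * v : ℝ) : ℂ) * Complex.I) *
          (χ ζ : ℂ)) (ξ / R) := by
        refine integral_congr_ae (.of_forall fun ξ => ?_)
        have e : ∀ u : ℝ, Complex.exp (2 * Real.pi * ξ * (v - u) * Complex.I) *
            ((normalQuarter u : ℂ) * w ξ) = Complex.exp (2 * Real.pi * ξ * v * Complex.I) * w ξ *
            (Complex.exp (-(2 * Real.pi * ξ * u * Complex.I)) * (normalQuarter u : ℂ)) := by
          intro u
          rw [show 2 * (Real.pi : ℂ) * ξ * (v - u) * Complex.I = 2 * Real.pi * ξ * v * Complex.I +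
            -(2 * Real.pi * ξ * u * Complex.I) by ring, Complex.exp_add]
          ring
        simp only [e]
        rw [integral_const_mul, integral_exp_mul_normalQuarter]
        simp only [hw]
        have h1 : (Real.exp (Real.pi ^ 2 * ξ ^ 2 / 2) : ℂ) *
            (Real.exp (-(Real.pi ^ 2 * ξ ^ 2 / 2)) : ℂ) = 1 := by
          rw [← Complex.ofReal_mul, ← Real.exp_add, add_neg_cancel, Real.exp_zero,
            Complex.ofReal_one]
        have hRc : (R : ℂ) ≠ 0 := by exact_mod_cast hR.ne'
        have h2 : 2 * (Real.pi : ℂ) * ((ξ / R : ℝ) : ℂ) * ((R * v : ℝ) : ℂ) * Complex.I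
            = 2 * Real.pi * ξ * v * Complex.I := by
          push_cast
          field_simp
        rw [h2]
        linear_combination Complex.exp (2 * Real.pi * ξ * v * Complex.I) * (χ (ξ / R) : ℂ) * h1
    _ = R * η (R * v) := by
        rw [Measure.integral_comp_div (fun ζ : ℝ => Complex.exp (2 * Real.pi * ζ *
          ((R * v : ℝ) : ℂ) * Complex.I) * (χ ζ : ℂ)) R, hη, abs_of_pos hR, Complex.real_smul]

theorem bddMeasurable_convolution {f k : ℝ → ℂ} {C : ℝ} (hf : BddMeasurable f C)
    (hkc : Continuous k) (hk : Integrable k) :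
    BddMeasurable (fun x => ∫ y, f (x - y) * k y) (C * ∫ y, ‖k y‖) := by
  refine ⟨?_, fun x => ?_⟩
  · have : StronglyMeasurable fun p : ℝ × ℝ => f (p.1 - p.2) * k p.2 := by
      have h1 := hf.measurable
      have h2 := hkc.measurable
      exact Measurable.stronglyMeasurable (by fun_prop)
    exact this.integral_prod_right.measurable
  · refine (norm_integral_le_integral_norm _).trans ?_
    rw [← integral_const_mul]
    refine integral_mono ((hf.comp (measurable_const.sub measurable_id)).integrable_mul hk).norm
      (hk.norm.const_mul C) fun y => ?_
    rw [norm_mul]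
    exact mul_le_mul_of_nonneg_right (hf.bound _) (norm_nonneg _)

/-- The Gaussian mean of `f ⋆ k` is the mean of `f` against the rescaled `η`. -/
theorem integral_convolution_mul_normalQuarter {f k η : ℝ → ℂ} {C R : ℝ} (hR : 0 < R)
    (hf : BddMeasurable f C) (hk : Integrable k)
    (hη : ∀ v, ∫ u, (normalQuarter u : ℂ) * k (v - u) = R * η (R * v)) (x : ℝ) :
    ∫ u, (∫ y, f (x + u - y) * k y) * (normalQuarter u : ℂ) = ∫ t, f (x - t / R) * η t := by
  have hint : Integrable (fun p : ℝ × ℝ => f (x - p.1) * ((normalQuarter p.2 : ℂ) *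
      k (p.1 - p.2))) (volume.prod volume) :=
    (hf.comp (measurable_const.sub measurable_fst)).integrable_mul
      (integrable_normalQuarter.ofReal.convolution_integrand (ContinuousLinearMap.mul ℂ ℂ) hk)
  calc ∫ u, (∫ y, f (x + u - y) * k y) * (normalQuarter u : ℂ)
      = ∫ u, (∫ y, f (x - u - y) * k y) * (normalQuarter u : ℂ) := by
        rw [← integral_neg_eq_self]
        simp only [normalQuarter, neg_sq, ← sub_eq_add_neg]
    _ = ∫ u, ∫ v, f (x - v) * ((normalQuarter u : ℂ) * k (v - u)) := by
        refine integral_congr_ae (.of_forall fun u => ?_)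
        simp only
        rw [← integral_sub_right_eq_self _ u, ← integral_mul_const]
        refine integral_congr_ae (.of_forall fun v => ?_)
        simp only [sub_sub, add_sub_cancel]
        ring
    _ = ∫ v, ∫ u, f (x - v) * ((normalQuarter u : ℂ) * k (v - u)) :=
        (integral_integral_swap hint).symm
    _ = ∫ v, (R : ℂ) * (fun t => f (x - t / R) * η t) (R * v) := by
        refine integral_congr_ae (.of_forall fun v => ?_)
        simp only [integral_const_mul, hη, mul_div_cancel_left₀ _ hR.ne']
        ring
    _ = ∫ t, f (x - t / R) * η t := by
        rw [integral_const_mul, Measure.integral_comp_mul_left (fun t => f (x - t / R) * η t) R,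
          abs_of_pos (inv_pos.2 hR), Complex.real_smul, ← mul_assoc, ← Complex.ofReal_mul, mul_inv_cancel₀ hR.ne',
          Complex.ofReal_one, one_mul]

theorem norm_gammaMean_sub_integral_normalQuarter_le {b : ℝ → ℂ} {B : ℝ}
    (hb : BddMeasurable b B) (N : ℕ) :
    ‖gammaMean N (fun s => b (Real.sqrt s)) -
      ∫ u, b (Real.sqrt N + u) * (normalQuarter u : ℂ)‖ ≤
      B * ∫ u, |rootDensity N u - normalQuarter u| := by
  have hb' := hb.comp (measurable_const_add (Real.sqrt N))
  have h1 : Integrable fun u => b (Real.sqrt N + u) * (rootDensity N u : ℂ) :=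
    hb'.integrable_mul (integrable_rootDensity N).ofReal
  have h2 : Integrable fun u => b (Real.sqrt N + u) * (normalQuarter u : ℂ) :=
    hb'.integrable_mul integrable_normalQuarter.ofReal
  rw [gammaMean_comp_sqrt, ← integral_sub h1 h2, ← integral_const_mul]
  refine (norm_integral_le_integral_norm _).trans (integral_mono (h1.sub h2).norm
    (((integrable_rootDensity N).sub integrable_normalQuarter).abs.const_mul B) fun u => ?_)
  have e : b (Real.sqrt N + u) * (rootDensity N u : ℂ) -
      b (Real.sqrt N + u) * (normalQuarter u : ℂ) =
      b (Real.sqrt N + u) * ((rootDensity N u - normalQuarter u : ℝ) : ℂ) := by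
    push_cast; ring
  simp only [e]
  rw [norm_mul, Complex.norm_real, Real.norm_eq_abs]
  exact mul_le_mul_of_nonneg_right (hb.bound _) (abs_nonneg _)

theorem tendsto_integral_norm_tail {η : ℝ → ℂ} (hη : Integrable η) {r : ℝ} (hr : 0 < r) :
    Filter.Tendsto (fun R : ℕ => ∫ t in {t : ℝ | R * r ≤ |t|}, ‖η t‖) Filter.atTop (nhds 0) := by
  have hms : ∀ R : ℕ, MeasurableSet {t : ℝ | R * r ≤ |t|} := fun R =>
    measurableSet_le measurable_const (by fun_prop)
  have h := tendsto_integral_of_dominated_convergence (μ := volume)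
    (F := fun R : ℕ => {t : ℝ | R * r ≤ |t|}.indicator fun t => ‖η t‖) (f := fun _ => (0 : ℝ))
    (fun t => ‖η t‖) (fun R => hη.norm.aestronglyMeasurable.indicator (hms R)) hη.norm
    (fun R => .of_forall fun t => by
      rw [Real.norm_of_nonneg (Set.indicator_nonneg (fun _ _ => norm_nonneg _) _)]
      exact Set.indicator_le_self' (fun _ _ => norm_nonneg _) t) (.of_forall fun t => ?_)
  · rw [integral_zero] at h
    refine h.congr fun R => integral_indicator (hms R)
  · refine tendsto_const_nhds.congr' ?_
    have : Filter.Tendsto (fun R : ℕ => (R : ℝ) * r) Filter.atTop Filter.atTop :=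
      tendsto_natCast_atTop_atTop.atTop_mul_const hr
    filter_upwards [this.eventually_gt_atTop |t|] with R hR
    exact (Set.indicator_of_notMem (show t ∉ {t : ℝ | R * r ≤ |t|} from not_le.2 hR) _).symm

/-- Rounding `(√(m + d) - v)²` down to an integer moves `√m` by hardly more than `|v|`, when `m`
is large. -/
theorem eventually_abs_sqrt_floor_sub_lt (d : ℕ) {δ : ℝ} (hδ : 0 < δ) :
    ∃ M : ℕ, ∀ m ≥ M, ∀ v : ℝ, |v| < δ / 2 →
      |Real.sqrt (⌊(Real.sqrt ((m + d : ℕ) : ℝ) - v) ^ 2⌋₊ : ℝ) - Real.sqrt m| < δ := by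
  have hsq : Filter.Tendsto (fun N : ℕ => Real.sqrt N) Filter.atTop Filter.atTop :=
    Real.tendsto_sqrt_atTop.comp tendsto_natCast_atTop_atTop
  obtain ⟨M, hM⟩ := Filter.eventually_atTop.1
    (hsq.eventually_ge_atTop (δ / 2 + 8 / δ + 8 * d / δ))
  refine ⟨M, fun m hm v hv => ?_⟩
  have h := hM m hm
  have h8 : 0 < 8 / δ := by positivity
  have h8d : 0 ≤ 8 * d / δ := by positivity
  set q := Real.sqrt m with hq
  set x := Real.sqrt ((m + d : ℕ) : ℝ) with hx
  have hq2 : q ^ 2 = m := Real.sq_sqrt (Nat.cast_nonneg _)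
  have hx2 : x ^ 2 = m + d := by rw [hx, Real.sq_sqrt (Nat.cast_nonneg _)]; push_cast; ring
  have hqx : q ≤ x := Real.sqrt_le_sqrt (by push_cast; linarith [Nat.cast_nonneg (α := ℝ) d])
  have hq0 : 0 < q := by linarith
  have hv' := abs_lt.1 hv
  -- `y = x - v` is at least `8 / δ`, and `√⌊y²⌋` is within `1 / y` of `y`
  set y := x - v with hy
  have hy8 : 8 / δ ≤ y := by rw [hy]; linarith
  have hy0 : 0 < y := by linarith
  have hδy : 8 ≤ y * δ := by rwa [div_le_iff₀ hδ] at hy8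
  set l := Real.sqrt (⌊y ^ 2⌋₊ : ℝ) with hl
  have hl0 : 0 ≤ l := Real.sqrt_nonneg _
  have hl2 : l ^ 2 = ⌊y ^ 2⌋₊ := Real.sq_sqrt (Nat.cast_nonneg _)
  have hf1 : l ^ 2 ≤ y ^ 2 := by rw [hl2]; exact Nat.floor_le (by positivity)
  have hf2 : y ^ 2 < l ^ 2 + 1 := by rw [hl2]; exact Nat.lt_floor_add_one _
  have hly : l ≤ y := le_of_sq_le_sq hf1 hy0.le
  have hyl : y - l ≤ δ / 8 := by
    by_contra hcon
    push Not at hcon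
    nlinarith
  have hdq : 8 * d ≤ q * δ := by
    have : 8 * d / δ ≤ q := by linarith
    rwa [div_le_iff₀ hδ] at this
  have hxq : x - q ≤ δ / 8 := by
    by_contra hcon
    push Not at hcon
    nlinarith
  rw [abs_lt]
  constructor <;> linarith

/-! ### Density in one variable -/

/-- Every bounded sequence that is uniformly continuous for the square-root metric is a uniform
limit of Gamma means. With `f(x) = σ(⌊x²⌋)`, the Gamma mean of `f ⋆ k` is, up to an error that
vanishes at infinity, the mean of `f` at `√m` against an approximate identity. -/
theorem approximable_of_sqrt_uniformContinuous (d : ℕ) {σ : ℕ → ℂ} {C : ℝ}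
    (hσ : ∀ m, ‖σ m‖ ≤ C)
    (huc : ∀ ε : ℝ, 0 < ε → ∃ δ : ℝ, 0 < δ ∧ ∀ m m' : ℕ,
      |Real.sqrt m - Real.sqrt m'| < δ → ‖σ m - σ m'‖ < ε) :
    Approximable d σ := by
  have hC : 0 ≤ C := (norm_nonneg _).trans (hσ 0)
  refine Approximable.of_eventually fun ε hε => ?_
  obtain ⟨η, hηi, hη1, hη⟩ := exists_deconvolution_kernel
  set A := ∫ t, ‖η t‖ with hA
  have hA0 : 0 ≤ A := integral_nonneg fun _ => norm_nonneg _
  obtain ⟨δ, hδ, hδσ⟩ := huc (ε / (4 * (A + 1))) (by positivity)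
  obtain ⟨R, hRtail, hR0⟩ := (((tendsto_integral_norm_tail hηi (half_pos hδ)).eventually
    (gt_mem_nhds (show 0 < ε / (8 * (C + 1)) by positivity))).and
    (Filter.eventually_gt_atTop 0)).exists
  have hR : (0 : ℝ) < R := by exact_mod_cast hR0
  obtain ⟨k, hkc, hki, hk⟩ := hη R hR
  set f : ℝ → ℂ := fun x => σ ⌊x ^ 2⌋₊ with hf
  have hfb : BddMeasurable f C := by
    refine ⟨?_, fun x => hσ _⟩
    have h1 : Measurable fun x : ℝ => ⌊x ^ 2⌋₊ := Nat.measurable_floor.comp (by fun_prop)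
    exact (measurable_of_countable σ).comp h1
  have hb := bddMeasurable_convolution hfb hkc hki
  set b : ℝ → ℂ := fun x => ∫ y, f (x - y) * k y with hbdef
  set B := C * ∫ y, ‖k y‖ with hB
  have hB0 : 0 ≤ B := mul_nonneg hC (integral_nonneg fun _ => norm_nonneg _)
  refine ⟨_, approximable_gammaMean d (hb.comp Real.continuous_sqrt.measurable), ?_⟩
  obtain ⟨M₁, hM₁⟩ := eventually_abs_sqrt_floor_sub_lt d hδ
  obtain ⟨M₂, hM₂⟩ := Filter.eventually_atTop.1 (tendsto_integral_abs_rootDensity_sub.eventually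
    (gt_mem_nhds (show 0 < ε / (2 * (B + 1)) by positivity)))
  refine ⟨max M₁ M₂, fun m hm => ?_⟩
  have hm₁ := hM₁ m ((le_max_left _ _).trans hm)
  have hm₂ := hM₂ (m + d) (((le_max_right _ _).trans hm).trans (Nat.le_add_right _ _))
  set x := Real.sqrt ((m + d : ℕ) : ℝ) with hx
  have h1 := norm_gammaMean_sub_integral_normalQuarter_le hb (m + d)
  have e1 : ∫ u, b (x + u) * (normalQuarter u : ℂ) = ∫ t, f (x - t / R) * η t :=
    integral_convolution_mul_normalQuarter hR hfb hki hk x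
  rw [← hx, e1] at h1
  have h2 : ‖(∫ t, f (x - t / R) * η t) - σ m‖ ≤ ε / 2 := by
    have e2 : σ m = ∫ t, σ m * η t := by rw [integral_const_mul, hη1, mul_one]
    have i1 : Integrable fun t => f (x - t / R) * η t :=
      (hfb.comp (measurable_const.sub (measurable_id.div_const _))).integrable_mul hηi
    have hms : MeasurableSet {t : ℝ | R * (δ / 2) ≤ |t|} :=
      measurableSet_le measurable_const (by fun_prop)
    rw [e2, ← integral_sub i1 (hηi.const_mul _)]
    have hle : ∀ t, ‖f (x - t / R) * η t - σ m * η t‖ ≤ ε / (4 * (A + 1)) * ‖η t‖ +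
        2 * C * {t : ℝ | R * (δ / 2) ≤ |t|}.indicator (fun t => ‖η t‖) t := by
      intro t
      rw [← sub_mul, norm_mul]
      by_cases ht : t ∈ {t : ℝ | R * (δ / 2) ≤ |t|}
      · rw [Set.indicator_of_mem ht]
        have h3 : ‖f (x - t / R) - σ m‖ ≤ 2 * C :=
          (norm_sub_le _ _).trans (by linarith [hfb.bound (x - t / R), hσ m])
        have h4 := mul_le_mul_of_nonneg_right h3 (norm_nonneg (η t))
        have h5 : 0 ≤ ε / (4 * (A + 1)) * ‖η t‖ := by positivity
        linarith
      · rw [Set.indicator_of_notMem ht, mul_zero, add_zero]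
        have ht' : |t / R| < δ / 2 := by
          rw [abs_div, abs_of_pos hR, div_lt_iff₀ hR, mul_comm]
          exact not_le.1 ht
        exact mul_le_mul_of_nonneg_right (hδσ _ _ (hm₁ _ ht')).le (norm_nonneg _)
    have i2 : Integrable fun t => ε / (4 * (A + 1)) * ‖η t‖ := hηi.norm.const_mul _
    have i3 : Integrable fun t => 2 * C *
        {t : ℝ | R * (δ / 2) ≤ |t|}.indicator (fun t => ‖η t‖) t :=
      (hηi.norm.indicator hms).const_mul _
    refine (norm_integral_le_integral_norm _).trans ((integral_mono
      (i1.sub (hηi.const_mul _)).norm (i2.add i3) hle).trans ?_)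
    simp only [Pi.add_apply]
    rw [integral_add i2 i3, integral_const_mul, integral_const_mul, integral_indicator hms, ← hA]
    have t1 : ε / (4 * (A + 1)) * A ≤ ε / 4 := by
      rw [div_mul_eq_mul_div, div_le_div_iff₀ (by positivity) (by positivity)]
      nlinarith
    have t2 : 2 * C * ∫ t in {t : ℝ | R * (δ / 2) ≤ |t|}, ‖η t‖ ≤ ε / 4 := by
      calc _ ≤ 2 * C * (ε / (8 * (C + 1))) := by gcongr
        _ ≤ ε / 4 := by
          rw [mul_div_assoc', div_le_div_iff₀ (by positivity) (by positivity)]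
          nlinarith
    linarith
  have h3 : B * ∫ u, |rootDensity (m + d) u - normalQuarter u| ≤ ε / 2 := by
    calc _ ≤ B * (ε / (2 * (B + 1))) := by gcongr
      _ ≤ ε / 2 := by
        rw [mul_div_assoc', div_le_div_iff₀ (by positivity) (by positivity)]
        nlinarith
  have h4 := norm_add_le (gammaMean (m + d) (fun s => b (Real.sqrt s)) -
    ∫ t, f (x - t / R) * η t) ((∫ t, f (x - t / R) * η t) - σ m)
  rw [sub_add_sub_cancel] at h4
  linarith

/-! ### Eigenvalue functions of tensor symbols -/

variable {k : ℕ} {n : Fin k → ℕ}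

theorem BddMeasurable.memLp_top {X : Type*} [MeasurableSpace X] {μ : Measure X} {b : X → ℂ}
    {C : ℝ} (hb : BddMeasurable b C) : MemLp b ∞ μ :=
  memLp_top_of_bound hb.measurable.aestronglyMeasurable C (.of_forall hb.bound)

theorem exists_tensorSymbols_ae_eq {b : Fin k → ℝ → ℂ} {C : Fin k → ℝ}
    (hb : ∀ j, BddMeasurable (b j) (C j)) :
    ∃ a ∈ tensorSymbols k, a =ᵐ[orthantMeasure k] fun r => ∏ j, b j (r j) := by
  have h := (BddMeasurable.prod hb).memLp_top (μ := orthantMeasure k)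
  refine ⟨h.toLp, Submodule.subset_span ⟨fun j => (hb j).memLp_top.toLp, ?_⟩, h.coeFn_toLp⟩
  exact h.coeFn_toLp.trans (ae_eq_prod_of_ae_eq fun j => (hb j).memLp_top.coeFn_toLp).symm

theorem prod_pullback_apply (F : Fin k → Cbu 1) (m : Fin k → ℕ) :
    (∏ j, pullback j (F j)) m = ∏ j, (F j : LInfty 1) fun _ => m j := by
  rw [← tensorToFun_tprod, tensorToFun_tprod_apply]

theorem prod_pullback_mem_algTensor (F : Fin k → Cbu 1) :
    ∏ j, pullback j (F j) ∈ algTensor k := by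
  rw [← tensorToFun_tprod]
  exact ⟨_, rfl⟩

/-- The functions in `C_{b,u}(ℕ₀, ρ₁)` that are eigenvalue functions for `ℂ^{d + 1}`, with radial
symbol `b`. -/
def radialEigenvalues (d : ℕ) : Set (Cbu 1) :=
  {F | ∃ (C : ℝ) (b : ℝ → ℂ), BddMeasurable b C ∧
    ∀ m, (F : LInfty 1) m = gammaMean (m 0 + d) fun s => b (Real.sqrt s)}

theorem exists_mem_radialEigenvalues {b : ℝ → ℂ} {C : ℝ} (hb : BddMeasurable b C) (d : ℕ) :
    ∃ F ∈ radialEigenvalues d,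
      ∀ m, (F : LInfty 1) m = gammaMean (m 0 + d) fun s => b (Real.sqrt s) := by
  obtain ⟨F, hF⟩ := exists_Cbu_gammaMean (hb.comp Real.continuous_sqrt.measurable) d
  exact ⟨F, ⟨C, b, hb, hF⟩, hF⟩

theorem dense_radialEigenvalues (d : ℕ) : Dense (radialEigenvalues d) := by
  intro F
  rw [Metric.mem_closure_iff]
  intro ε hε
  have happ : Approximable d fun i => (F : LInfty 1) fun _ => i := by
    refine approximable_of_sqrt_uniformContinuous d (C := ‖(F : LInfty 1)‖)
      (fun i => (F : LInfty 1).norm_coe_le_norm _) fun ε hε => ?_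
    obtain ⟨δ, hδ, H⟩ := F.2 ε hε
    refine ⟨δ, hδ, fun i i' h => H _ _ ?_⟩
    simpa [sqrtDist] using h
  obtain ⟨C, b, hb, H⟩ := happ (ε / 2) (half_pos hε)
  obtain ⟨G, hG, hGb⟩ := exists_mem_radialEigenvalues (hb.comp (measurable_id.pow_const 2)) d
  refine ⟨G, hG, lt_of_le_of_lt ?_ (half_lt_self hε)⟩
  rw [Subtype.dist_eq, dist_comm, BoundedContinuousFunction.dist_le (half_pos hε).le]
  intro m
  have e : (fun _ : Fin 1 => m 0) = m := funext fun j => by rw [Subsingleton.elim j 0]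
  have e' : (G : LInfty 1) m = gammaMean (m 0 + d) b := by
    rw [hGb]
    exact gammaMean_congr fun s hs => by simp only [id, Real.sq_sqrt hs.le]
  have := H (m 0)
  simp only [e] at this
  rwa [← e', ← dist_eq_norm] at this

theorem isEigenvalueFunction_prod_pullback (hn : ∀ j, 1 ≤ n j) {b : Fin k → ℝ → ℂ}
    {C : Fin k → ℝ} (hb : ∀ j, BddMeasurable (b j) (C j)) {F : Fin k → Cbu 1}
    (hF : ∀ j m, (F j : LInfty 1) m = gammaMean (m 0 + (n j - 1)) fun s => b j (Real.sqrt s)) :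
    IsEigenvalueFunction n (fun r => ∏ j, b j (r j)) (∏ j, pullback j (F j) : LInfty k) := by
  convert! isEigenvalueFunction_prod hn hb using 1
  funext m
  rw [prod_pullback_apply]
  exact Finset.prod_congr rfl fun j _ => hF j _

theorem prod_pullback_mem_tensorEigenvalueFunctions (hn : ∀ j, 1 ≤ n j) {F : Fin k → Cbu 1}
    (hF : ∀ j, F j ∈ radialEigenvalues (n j - 1)) :
    ∏ j, pullback j (F j) ∈ tensorEigenvalueFunctions n := by
  choose C b hb hFb using hF
  obtain ⟨a, ha, hab⟩ := exists_tensorSymbols_ae_eq hb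
  exact ⟨a, ha, (isEigenvalueFunction_prod_pullback hn hb hFb).congr_ae hn hab.symm⟩

/-- Existence of eigenvalue functions, by linearity from products; they are combinations of
products of functions in `C_{b,u}(ℕ₀, ρ₁)`. -/
theorem exists_isEigenvalueFunction (hn : ∀ j, 1 ≤ n j) {a : Lp ℂ ∞ (orthantMeasure k)}
    (ha : a ∈ tensorSymbols k) : ∃ γ ∈ algTensor k, IsEigenvalueFunction n a γ := by
  suffices h : ∃ (C : ℝ) (a' : (Fin k → ℝ) → ℂ), BddMeasurable a' C ∧
      a =ᵐ[orthantMeasure k] a' ∧ ∃ γ ∈ algTensor k, IsEigenvalueFunction n a' γ by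
    obtain ⟨C, a', -, haa', γ, hγ, h⟩ := h
    exact ⟨γ, hγ, h.congr_ae hn haa'.symm⟩
  induction ha using Submodule.span_induction with
  | mem a ha =>
    obtain ⟨B, hB⟩ := ha
    choose C b hb hBb using fun j => exists_bddMeasurable_ae_eq (B j)
    choose F hF hFb using fun j => exists_mem_radialEigenvalues (hb j) (n j - 1)
    exact ⟨_, _, BddMeasurable.prod hb, hB.trans (ae_eq_prod_of_ae_eq hBb), _,
      prod_pullback_mem_algTensor F, isEigenvalueFunction_prod_pullback hn hb hFb⟩
  | zero =>
    refine ⟨0, fun _ => 0, ⟨measurable_const, by simp⟩, Lp.coeFn_zero _ _ _, 0, zero_mem _, ?_⟩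
    rintro m f ⟨p, -, rfl⟩
    funext z
    rw [toeplitz_eval]
    simp [quasiRadial]
  | add a₁ a₂ _ _ h₁ h₂ =>
    obtain ⟨C₁, b₁, hb₁, hab₁, γ₁, hγ₁, he₁⟩ := h₁
    obtain ⟨C₂, b₂, hb₂, hab₂, γ₂, hγ₂, he₂⟩ := h₂
    exact ⟨_, _, hb₁.add hb₂, (Lp.coeFn_add a₁ a₂).trans (hab₁.add hab₂), γ₁ + γ₂,
      add_mem hγ₁ hγ₂, he₁.add hb₁ hb₂ he₂⟩
  | smul c a _ h =>
    obtain ⟨C, b, hb, hab, γ, hγ, he⟩ := h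
    exact ⟨_, _, hb.const_mul c, (Lp.coeFn_smul c a).trans (hab.const_smul c), c • γ,
      (algTensor k).smul_mem hγ c, he.const_mul c⟩

/-- The set `𝔊̃_n` as a linear subspace of `ℓ^∞(ℕ₀^k)`. -/
def tensorEigenvalueSubmodule (n : Fin k → ℕ) (hn : ∀ j, 1 ≤ n j) : Submodule ℂ (LInfty k) where
  carrier := tensorEigenvalueFunctions n
  add_mem' := by
    rintro γ₁ γ₂ ⟨a₁, ha₁, h₁⟩ ⟨a₂, ha₂, h₂⟩
    obtain ⟨C₁, b₁, hb₁, hab₁⟩ := exists_bddMeasurable_ae_eq a₁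
    obtain ⟨C₂, b₂, hb₂, hab₂⟩ := exists_bddMeasurable_ae_eq a₂
    exact ⟨a₁ + a₂, add_mem ha₁ ha₂, ((h₁.congr_ae hn hab₁).add hb₁ hb₂
      (h₂.congr_ae hn hab₂)).congr_ae hn ((Lp.coeFn_add a₁ a₂).trans (hab₁.add hab₂)).symm⟩
  zero_mem' := by
    refine ⟨0, zero_mem _, IsEigenvalueFunction.congr_ae hn (Lp.coeFn_zero _ _ _).symm ?_⟩
    rintro m f ⟨p, -, rfl⟩
    funext z
    rw [toeplitz_eval]
    simp [quasiRadial]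
  smul_mem' := by
    rintro c γ ⟨a, ha, h⟩
    exact ⟨c • a, Submodule.smul_mem _ c ha,
      (h.const_mul c).congr_ae hn (Lp.coeFn_smul c a).symm⟩

theorem continuous_pullback (j : Fin k) : Continuous (pullback j) := by
  refine LipschitzWith.continuous (K := 1) (LipschitzWith.of_dist_le_mul fun F G => ?_)
  rw [NNReal.coe_one, one_mul, BoundedContinuousFunction.dist_le dist_nonneg]
  intro m
  exact BoundedContinuousFunction.dist_coe_le_dist (f := (F : LInfty 1)) (g := (G : LInfty 1)) _

/-- Products are continuous in their factors, so that density in each variable gives the closure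
of the whole tensor product. -/
theorem prod_pullback_mem_closure (hn : ∀ j, 1 ≤ n j) (F : Fin k → Cbu 1) :
    ∏ j, pullback j (F j) ∈ closure (tensorEigenvalueFunctions n) := by
  have hcont : Continuous fun F : Fin k → Cbu 1 => ∏ j, pullback j (F j) :=
    continuous_finsetProd _ fun j _ => (continuous_pullback j).comp (continuous_apply j)
  refine map_mem_closure hcont (s := Set.univ.pi fun j => radialEigenvalues (n j - 1)) ?_
    fun G hG => prod_pullback_mem_tensorEigenvalueFunctions hn fun j => hG j trivial
  rw [closure_pi_set]
  exact fun j _ => dense_radialEigenvalues _ (F j)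

theorem algTensor_subset_closure (hn : ∀ j, 1 ≤ n j) :
    (algTensor k : Set (LInfty k)) ⊆ closure (tensorEigenvalueFunctions n) := by
  rintro _ ⟨x, rfl⟩
  change tensorToFun k x ∈ (tensorEigenvalueSubmodule n hn).topologicalClosure
  induction x using PiTensorProduct.induction_on with
  | smul_tprod r F =>
    rw [map_smul, tensorToFun_tprod]
    exact Submodule.smul_mem _ r (prod_pullback_mem_closure hn F)
  | add x y hx hy =>
    rw [map_add]
    exact add_mem hx hy

end QuasiRadial
end

theorem mainTheorem7 (k : ℕ) (hk : 1 ≤ k) (n : Fin k → ℕ) (hn : ∀ j, 1 ≤ n j) :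
    (∀ a ∈ QuasiRadial.tensorSymbols k,
      ∃! γ : QuasiRadial.LInfty k, QuasiRadial.IsEigenvalueFunction n a γ) ∧
    closure (QuasiRadial.tensorEigenvalueFunctions n) =
      (QuasiRadial.cstarTensor k : Set (QuasiRadial.LInfty k)) := by
  refine ⟨fun a ha => ?_, Set.Subset.antisymm ?_ ?_⟩
  · obtain ⟨γ, -, h⟩ := QuasiRadial.exists_isEigenvalueFunction hn ha
    exact ⟨γ, h, fun γ' h' => DFunLike.coe_injective (h'.unique hn h)⟩
  · refine closure_mono ?_
    rintro γ ⟨a, ha, h⟩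
    obtain ⟨γ', hγ', h'⟩ := QuasiRadial.exists_isEigenvalueFunction hn ha
    rwa [DFunLike.coe_injective (h.unique hn h')]
  · exact closure_minimal (QuasiRadial.algTensor_subset_closure hn) isClosed_closure
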